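/- Let $\sigma_x,c_1,c_2>0$ be fixed. There is a constant $C_0>0$ depending only on $\sigma_x,c_1,c_2$ such that the following holds for every constant $C_1$, every fixed integer $k\ge 0$ and every constant $0\le\nu<1$. Consider a sequence of linear models $y=X\beta^*+\varepsilon$ with $X\in\mathbb R^{N\times n}$, $N\ge1$, along which $n\to\infty$ (the index of the sequence is suppressed; $N$, the graph, $\beta^*$ and all quantities below except $\sigma_x,c_1,c_2,C_0,C_1,k,\nu$ may change along it). Let $\mathcal G$ be a simple graph on $\{1,\dots,n\}$ with maximum degree $d\ge 2$ and $p$ edges, let $F\in\{-1,0,1\}^{p\times n}$ be its oriented incidence matrix (the row $F_j^T$ of an edge $(u,v)$, $u<v$, has $-1$ in entry $u$ and $+1$ in entry $v$), $L=F^TF$, and let $\Delta^{(k+1)}=FL^{k/2}$ for even $k$ and $\Delta^{(k+1)}=L^{(k+1)/2}$ for odd $k$. Assume: - $\|\Delta^{(k+1)}\beta^*\|_0\le s_1$ and $\|\beta^*\|_0\le s_2$, where $s_1,s_2\ge1$ are integers with $s_2/s_1\ge\nu$. - The rows of $X$ are i.i.d. with covariance matrix $\Sigma_x$ and are $\sigma_x$-sub-Gaussian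 (mean zero, and $\mathbb E\exp(t\,u^TX_i)\le\exp(\sigma_x^2t^2/2)$ for all $t\in\mathbb R$ and all unit vectors $u$); the eigenvalues of $\Sigma_x$ lie in $[c_1,c_2]$, and $\Theta_x=\Sigma_x^{-1}$ satisfies $\max_i\sum_j|(\Theta_x)_{ij}|\le M_n$. - $\varepsilon\sim N(0,\sigma_\varepsilon^2I_N)$ with $\sigma_\varepsilon>0$, independent of $X$. - $C_0\sigma_\varepsilon\sqrt{\log n/N}\le\lambda\le C_1\sigma_\varepsilon\sqrt{\log n/N}$, $\ \lambda_g=\lambda\sqrt{\nu/(2d)^{k+1}}$, and $C_0\sqrt{\log n/N}\le\mu\le C_1\sqrt{\log n/N}$. Let $\hat\beta$ be a (measurable) minimizer over $\beta\in\mathbb R^n$ of $\frac1{2N}\|y-X\beta\|_2^2+\lambda_g\|\Delta^{(k+1)}\beta\|_1+\lambda\|\beta\|_1$. Let $\Sigma_N=\frac1NX^TX$, and let $\widehat\Theta$ be a measurable function of $X$ which, whenever the feasible set is non-empty, minimizes $\sum_{i,j}|\Theta_{ij}|$ over the $\Theta\in\mathbb R^{n\times n}$ with $\max_{i,j}|(\Theta\Sigma_N-I_n)_{ij}|\le\mu$.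 Let $\tilde\beta=\hat\beta+\frac1N\widehat\Theta X^T(y-X\hat\beta)$ and $\hat\sigma_\varepsilon=\big(\frac1N\sum_{i=1}^N(y_i-X_i^T\hat\beta)^2\big)^{1/2}$. If $dM_n\sqrt{\log n/N}\to0$ and $s_2\log n\sqrt{d/N}\to0$, then for every choice of an edge $j$ of each graph, $$\frac{\sqrt N(F_j^T\tilde\beta-F_j^T\beta^*)}{\sigma_\varepsilon\sqrt{F_j^T\widehat\Theta\Sigma_N\widehat\Theta^TF_j}}\to N(0,1)\quad\text{and}\quad\frac{\sqrt N(F_j^T\tilde\beta-F_j^T\beta^*)}{\hat\sigma_\varepsilon\sqrt{F_j^T\widehat\Theta\Sigma_N\widehat\Theta^TF_j}}\to N(0,1)$$ in distribution. Consequently, let $0<\alpha<1$, let $\Phi$ be the standard normal distribution function, and suppose that $\beta^*_u=\beta^*_v$ for the chosen edges $j=(u,v)$. Then the test that rejects $\beta^*_u=\beta^*_v$ when $|Z'_j|>\Phi^{-1}(1-\alpha/2)$ has rejection probability tending to $\alpha$, both for $Z'_j=\sqrt N F_j^T\tilde\beta\big/\big(\sigma_\varepsilon\sqrt{F_j^T\widehat\Theta\Sigma_N\widehat\Theta^TF_j}\big)$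 and for $Z'_j=\sqrt N F_j^T\tilde\beta\big/\big(\hat\sigma_\varepsilon\sqrt{F_j^T\widehat\Theta\Sigma_N\widehat\Theta^TF_j}\big)$. -/

import Mathlib

open MeasureTheory ProbabilityTheory Filter Topology Matrix

namespace GraphLasso

noncomputable section

/-! ### Graph difference operators -/

/-- The edges of a graph on `Fin n`, each written as the pair `(i, j)` with `i < j`. -/
abbrev Edge {n : ℕ} (G : SimpleGraph (Fin n)) : Type :=
  {e : Fin n × Fin n // e.1 < e.2 ∧ G.Adj e.1 e.2}

/-- The oriented incidence matrix `F`: the row of the edge `(i, j)`, `i < j`, has `-1` in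
column `i`, `+1` in column `j` and `0` elsewhere. -/
def incidence {n : ℕ} (G : SimpleGraph (Fin n)) : Matrix (Edge G) (Fin n) ℝ :=
  Matrix.of fun e v => if v = e.1.1 then -1 else if v = e.1.2 then 1 else 0

/-- The graph Laplacian `L = Fᵀ F`. -/
def laplacian {n : ℕ} (G : SimpleGraph (Fin n)) [DecidableRel G.Adj] :
    Matrix (Fin n) (Fin n) ℝ :=
  (incidence G)ᵀ * incidence G

/-- The row index of the graph difference operator of order `k + 1`: edges for even `k`,
nodes for odd `k`. -/
def DiffRow {n : ℕ} (G : SimpleGraph (Fin n)) : ℕ → Type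
  | 0 => Edge G
  | 1 => Fin n
  | k + 2 => DiffRow G k

instance instFintypeDiffRow {n : ℕ} (G : SimpleGraph (Fin n)) [DecidableRel G.Adj] :
    ∀ k : ℕ, Fintype (DiffRow G k)
  | 0 => inferInstanceAs (Fintype (Edge G))
  | 1 => inferInstanceAs (Fintype (Fin n))
  | k + 2 => instFintypeDiffRow G k

/-- The graph difference operator `Δ^(k+1)` of order `k + 1`: it is `F L^(k/2)` for even `k` and
`L^((k+1)/2)` for odd `k`. -/
def graphDiff {n : ℕ} (G : SimpleGraph (Fin n)) [DecidableRel G.Adj] :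
    (k : ℕ) → Matrix (DiffRow G k) (Fin n) ℝ
  | 0 => incidence G
  | 1 => laplacian G
  | k + 2 => (graphDiff G k * laplacian G : Matrix (DiffRow G k) (Fin n) ℝ)

/-- The parameter space `S(k, s₁, s₂)` of vectors that are `(k, s₁)`-piecewise polynomial over the
graph and `s₂`-sparse. -/
def paramSpace {n : ℕ} (G : SimpleGraph (Fin n)) [DecidableRel G.Adj] (k s₁ s₂ : ℕ) :
    Set (Fin n → ℝ) :=
  {β | hammingNorm (graphDiff G k *ᵥ β) ≤ s₁ ∧ hammingNorm β ≤ s₂}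

/-! ### The random linear model -/

/-- A real random variable is `σ`-sub-Gaussian: it has mean zero and its moment generating
function is (finite and) at most `exp (σ² t² / 2)` for all `t`. -/
structure IsSubGaussian {Ω : Type*} [MeasurableSpace Ω] (σ : ℝ) (Z : Ω → ℝ) (P : Measure Ω) :
    Prop where
  mean_zero : ∫ ω, Z ω ∂P = 0
  mgf_bound : HasSubgaussianMGF Z (σ ^ 2).toNNReal P

/-- A random vector is `σ`-sub-Gaussian: it has mean zero and all its projections on unit vectors
are `σ`-sub-Gaussian. -/
structure IsSubGaussianVector {Ω : Type*} [MeasurableSpace Ω] {n : ℕ} (σ : ℝ)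
    (V : Ω → Fin n → ℝ) (P : Measure Ω) : Prop where
  mean_zero : ∀ a, ∫ ω, V ω a ∂P = 0
  projection : ∀ u : Fin n → ℝ, u ⬝ᵥ u = 1 → IsSubGaussian σ (fun ω => u ⬝ᵥ V ω) P

/-- `X` is a row-wise `(σ, S)`-sub-Gaussian random matrix: its rows are i.i.d. draws from a
`σ`-sub-Gaussian distribution with covariance matrix `S`. -/
structure IsRowwiseSubGaussian {Ω : Type*} [MeasurableSpace Ω] {N n : ℕ} (σ : ℝ)
    (S : Matrix (Fin n) (Fin n) ℝ) (X : Ω → Matrix (Fin N) (Fin n) ℝ) (P : Measure Ω) :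
    Prop where
  measurable_row : ∀ i, Measurable fun ω => X ω i
  indep_rows : iIndepFun (fun i ω => X ω i) P
  ident_rows : ∀ i i', IdentDistrib (fun ω => X ω i) (fun ω => X ω i') P P
  subGaussian_row : ∀ i, IsSubGaussianVector σ (fun ω => X ω i) P
  cov_row : ∀ i a b, covariance (fun ω => X ω i a) (fun ω => X ω i b) P = S a b

/-- `ε` has the law `N(0, σ² I_N)`: its components are i.i.d. `N(0, σ²)`. -/
structure IsGaussianNoise {Ω : Type*} [MeasurableSpace Ω] {N : ℕ} (σ : ℝ)
    (ε : Ω → Fin N → ℝ) (P : Measure Ω) : Prop where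
  measurable_noise : Measurable ε
  indep : iIndepFun (fun i ω => ε ω i) P
  law : ∀ i, P.map (fun ω => ε ω i) = gaussianReal 0 (σ ^ 2).toNNReal

/-! ### The estimators -/

/-- The objective `(2N)⁻¹ ‖y - X β‖₂² + lamG ‖Δ^(k+1) β‖₁ + lam ‖β‖₁`. -/
def objective {N n : ℕ} (G : SimpleGraph (Fin n)) [DecidableRel G.Adj] (k : ℕ) (lamG lam : ℝ)
    (X : Matrix (Fin N) (Fin n) ℝ) (y : Fin N → ℝ) (β : Fin n → ℝ) : ℝ :=
  1 / (2 * (N : ℝ)) * ∑ i, (y i - (X *ᵥ β) i) ^ 2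
    + lamG * ∑ r, |(graphDiff G k *ᵥ β) r| + lam * ∑ a, |β a|

/-- `βhat` is a `k`-th order Graph-Piecewise-Polynomial-Lasso estimate for the data `(X, y)`. -/
def IsGraphLasso {N n : ℕ} (G : SimpleGraph (Fin n)) [DecidableRel G.Adj] (k : ℕ)
    (lamG lam : ℝ) (X : Matrix (Fin N) (Fin n) ℝ) (y : Fin N → ℝ) (βhat : Fin n → ℝ) : Prop :=
  ∀ β : Fin n → ℝ, objective G k lamG lam X y βhat ≤ objective G k lamG lam X y β

/-- The sample covariance matrix `Σ_N = Xᵀ X / N`. -/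
def sampleCov {N n : ℕ} (X : Matrix (Fin N) (Fin n) ℝ) : Matrix (Fin n) (Fin n) ℝ :=
  (1 / (N : ℝ)) • (Xᵀ * X)

/-- The constraint `‖Θ S - I‖_∞ ≤ μ` (element-wise sup norm). -/
def CLIMEFeasible {n : ℕ} (S : Matrix (Fin n) (Fin n) ℝ) (μ : ℝ)
    (Θ : Matrix (Fin n) (Fin n) ℝ) : Prop :=
  ∀ a b, |(Θ * S - 1) a b| ≤ μ

/-- `Θ` solves the CLIME problem: it minimizes the element-wise `ℓ₁`-norm subject to the
constraint `‖Θ S - I‖_∞ ≤ μ`. -/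
def IsCLIME {n : ℕ} (S : Matrix (Fin n) (Fin n) ℝ) (μ : ℝ)
    (Θ : Matrix (Fin n) (Fin n) ℝ) : Prop :=
  CLIMEFeasible S μ Θ ∧
    ∀ Θ' : Matrix (Fin n) (Fin n) ℝ, CLIMEFeasible S μ Θ' →
      ∑ a, ∑ b, |Θ a b| ≤ ∑ a, ∑ b, |Θ' a b|

/-- A measurable selection `Θhat` of the CLIME estimator: a measurable function of the design
matrix that solves the CLIME problem for `Σ_N` whenever that problem has a feasible point (and
may take any value otherwise). -/
structure IsCLIMEEstimator {N n : ℕ} (μ : ℝ)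
    (Θhat : Matrix (Fin N) (Fin n) ℝ → Matrix (Fin n) (Fin n) ℝ) : Prop where
  measurable_entry : ∀ a b, Measurable fun x : Fin N → Fin n → ℝ => Θhat (Matrix.of x) a b
  solves : ∀ X : Matrix (Fin N) (Fin n) ℝ,
    (∃ Θ, CLIMEFeasible (sampleCov X) μ Θ) → IsCLIME (sampleCov X) μ (Θhat X)

/-- The one-step estimator `βhat + Θ Xᵀ (y - X βhat) / N`. -/
def oneStep {N n : ℕ} (X : Matrix (Fin N) (Fin n) ℝ) (y : Fin N → ℝ) (βhat : Fin n → ℝ)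
    (Θ : Matrix (Fin n) (Fin n) ℝ) : Fin n → ℝ :=
  βhat + (1 / (N : ℝ)) • ((Θ * Xᵀ) *ᵥ (y - X *ᵥ βhat))

/-- The noise level estimate `(N⁻¹ ∑ᵢ (yᵢ - Xᵢᵀ βhat)²)^(1/2)`. -/
def sigmaHat {N n : ℕ} (X : Matrix (Fin N) (Fin n) ℝ) (y : Fin N → ℝ) (βhat : Fin n → ℝ) : ℝ :=
  √(1 / (N : ℝ) * ∑ i, (y i - (X *ᵥ βhat) i) ^ 2)

/-- For the edge `e` with row `f` of the oriented incidence matrix, a noise level `s` and a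
centring `c`: the statistic `√N (fᵀ βtilde - c) / (s √(fᵀ Θ Σ_N Θᵀ f))`, where `βtilde` is the
one-step estimator. -/
def edgeStat {N n : ℕ} (G : SimpleGraph (Fin n)) (e : Edge G) (s c : ℝ)
    (X : Matrix (Fin N) (Fin n) ℝ) (y : Fin N → ℝ) (βhat : Fin n → ℝ)
    (Θ : Matrix (Fin n) (Fin n) ℝ) : ℝ :=
  √(N : ℝ) * (incidence G e ⬝ᵥ oneStep X y βhat Θ - c)
    / (s * √(incidence G e ⬝ᵥ ((Θ * sampleCov X * Θᵀ) *ᵥ incidence G e)))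

end

end GraphLasso

/-! With probability at least `1 - 10 / n` the sample covariance matrix is entrywise within a
multiple of `√(log n / N)` of the population one and the noise is nearly uncorrelated with the
design. On this event the graph penalty, calibrated by the bound `(2d)^(k+1)` on the squared norm of
the difference operator, is dominated by `λ √s₂` times the Euclidean error, so the basic inequality
of the lasso puts the estimation error into a cone on which the sample covariance is positive
definite, and its `ℓ₁`-norm is of order `s₂ λ`. The inverse covariance matrix is CLIME-feasible on
the same event. The debiased statistic is therefore the projection of `ε / σ` onto the unit vector
along `X Θᵀ f`, up to a bias of order `s₂ log n / √N`; conditionally on `X`, hence also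
unconditionally, this projection is exactly `N(0, 1)`. -/

namespace GraphLasso

section SubexponentialVariables

variable {Ω ι : Type*} [MeasurableSpace Ω] [Fintype ι] {P : Measure Ω} {Z : Ω → ℝ} {s t : ℝ}

/-- A random variable whose Orlicz `ψ₁`-norm is at most one. Bernstein's inequality is proved for
sums of independent variables of this kind. -/
structure IsUnitSubexponential (Z : Ω → ℝ) (P : Measure Ω) : Prop where
  aemeasurable : AEMeasurable Z P
  integrable_exp_abs : Integrable (fun ω => Real.exp |Z ω|) P
  integral_exp_abs_le : ∫ ω, Real.exp |Z ω| ∂P ≤ 2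

lemma exp_le_one_add_add_sq_mul_exp_abs (x : ℝ) :
    Real.exp x ≤ 1 + x + x ^ 2 * Real.exp |x| := by
  have h := Complex.norm_exp_sub_sum_le_norm_mul_exp (x : ℂ) 2
  have h_sum : Complex.exp x - ∑ m ∈ Finset.range 2, (x : ℂ) ^ m / m.factorial
      = ((Real.exp x - (1 + x) : ℝ) : ℂ) := by
    simp [Finset.sum_range_succ]
  rw [h_sum, Complex.norm_real, Complex.norm_real, Real.norm_eq_abs, Real.norm_eq_abs, sq_abs] at h
  linarith [le_abs_self (Real.exp x - (1 + x))]

lemma sq_le_eight_mul_exp_abs_div_two (x : ℝ) : x ^ 2 ≤ 8 * Real.exp (|x| / 2) := by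
  have := Real.quadratic_le_exp_of_nonneg (x := |x| / 2) (by positivity)
  nlinarith [sq_abs x, abs_nonneg x]

lemma exp_mul_le_of_abs_le_half (x : ℝ) (ht : |t| ≤ 1 / 2) :
    Real.exp (t * x) ≤ 1 + t * x + 8 * t ^ 2 * Real.exp |x| := by
  have h_exp : Real.exp |t * x| ≤ Real.exp (|x| / 2) := by
    apply Real.exp_le_exp.2
    rw [abs_mul]
    nlinarith [abs_nonneg x]
  have h_rem : (t * x) ^ 2 * Real.exp |t * x| ≤ 8 * t ^ 2 * Real.exp |x| :=
    calc (t * x) ^ 2 * Real.exp |t * x|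
        ≤ t ^ 2 * (8 * Real.exp (|x| / 2)) * Real.exp (|x| / 2) := by
          rw [mul_pow]
          gcongr
          exact sq_le_eight_mul_exp_abs_div_two x
      _ = 8 * t ^ 2 * (Real.exp (|x| / 2) * Real.exp (|x| / 2)) := by ring
      _ = 8 * t ^ 2 * Real.exp |x| := by rw [← Real.exp_add, add_halves]
  linarith [exp_le_one_add_add_sq_mul_exp_abs (t * x)]

namespace IsUnitSubexponential

lemma neg (hZ : IsUnitSubexponential Z P) : IsUnitSubexponential (fun ω => -Z ω) P where
  aemeasurable := hZ.aemeasurable.neg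
  integrable_exp_abs := by simpa only [abs_neg] using hZ.integrable_exp_abs
  integral_exp_abs_le := by simpa only [abs_neg] using hZ.integral_exp_abs_le

lemma integrable (hZ : IsUnitSubexponential Z P) : Integrable Z P := by
  refine hZ.integrable_exp_abs.mono' hZ.aemeasurable.aestronglyMeasurable (ae_of_all _ fun ω => ?_)
  rw [Real.norm_eq_abs]
  linarith [Real.add_one_le_exp |Z ω|]

lemma integrable_exp_mul (hZ : IsUnitSubexponential Z P) (ht : |t| ≤ 1) :
    Integrable (fun ω => Real.exp (t * Z ω)) P := by
  refine hZ.integrable_exp_abs.mono' (hZ.aemeasurable.const_mul t).exp.aestronglyMeasurable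
    (ae_of_all _ fun ω => ?_)
  rw [Real.norm_eq_abs, Real.abs_exp]
  apply Real.exp_le_exp.2
  calc t * Z ω ≤ |t| * |Z ω| := by rw [← abs_mul]; exact le_abs_self _
    _ ≤ |Z ω| := mul_le_of_le_one_left (abs_nonneg _) ht

lemma mgf_le [IsProbabilityMeasure P] (hZ : IsUnitSubexponential Z P) (ht : |t| ≤ 1 / 2) :
    mgf Z P t ≤ 1 + t * ∫ ω, Z ω ∂P + 16 * t ^ 2 := by
  have h_lin : Integrable (fun ω => 1 + t * Z ω) P :=
    (integrable_const 1).add (hZ.integrable.const_mul t)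
  have h_exp := hZ.integrable_exp_abs.const_mul (8 * t ^ 2)
  calc mgf Z P t ≤ ∫ ω, (1 + t * Z ω + 8 * t ^ 2 * Real.exp |Z ω|) ∂P :=
        integral_mono (hZ.integrable_exp_mul (by linarith)) (h_lin.add h_exp)
          fun ω => exp_mul_le_of_abs_le_half _ ht
    _ = 1 + t * ∫ ω, Z ω ∂P + 8 * t ^ 2 * ∫ ω, Real.exp |Z ω| ∂P := by
        rw [integral_add h_lin h_exp,
          integral_add (integrable_const _) (hZ.integrable.const_mul t), integral_const_mul,
          integral_const_mul]
        simp
    _ ≤ 1 + t * ∫ ω, Z ω ∂P + 16 * t ^ 2 := by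
        nlinarith [sq_nonneg t, hZ.integral_exp_abs_le]

lemma mgf_sub_integral_le [IsProbabilityMeasure P] (hZ : IsUnitSubexponential Z P)
    (ht : |t| ≤ 1 / 2) : mgf (fun ω => Z ω - ∫ ω, Z ω ∂P) P t ≤ Real.exp (16 * t ^ 2) := by
  set m := ∫ ω, Z ω ∂P
  simp only [sub_eq_add_neg, mgf_add_const]
  calc mgf Z P t * Real.exp (t * -m) ≤ Real.exp (t * m + 16 * t ^ 2) * Real.exp (t * -m) := by
        gcongr
        linarith [hZ.mgf_le ht, Real.add_one_le_exp (t * m + 16 * t ^ 2)]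
    _ = Real.exp (16 * t ^ 2) := by rw [← Real.exp_add]; ring_nf

lemma integrable_exp_mul_sub_integral (hZ : IsUnitSubexponential Z P) (ht : |t| ≤ 1) :
    Integrable (fun ω => Real.exp (t * (Z ω - ∫ ω, Z ω ∂P))) P := by
  simp only [mul_sub, Real.exp_sub]
  exact (hZ.integrable_exp_mul ht).div_const _

end IsUnitSubexponential

lemma integrable_exp_mul_sum {Z : ι → Ω → ℝ} (h_indep : iIndepFun Z P)
    (hZ : ∀ i, AEMeasurable (Z i) P) (h_int : ∀ i, Integrable (fun ω => Real.exp (t * Z i ω)) P) :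
    Integrable (fun ω => Real.exp (t * ∑ i, Z i ω)) P := by
  have := h_indep.isProbabilityMeasure
  by_contra h
  have h_mgf := h_indep.mgf_sum₀ (t := t) hZ Finset.univ
  rw [mgf, integral_undef (by simpa only [Finset.sum_apply] using h)] at h_mgf
  exact (Finset.prod_pos fun i _ => mgf_pos (h_int i)).ne h_mgf

lemma measureReal_le_sum_sub_integral_le [IsProbabilityMeasure P] {Z : ι → Ω → ℝ}
    (h_indep : iIndepFun Z P) (hZ : ∀ i, IsUnitSubexponential (Z i) P) (hs : 0 ≤ s)
    (hs16 : s ≤ 16) :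
    P.real {ω | Fintype.card ι * s ≤ ∑ i, (Z i ω - ∫ ω, Z i ω ∂P)}
      ≤ Real.exp (-(Fintype.card ι * s ^ 2 / 64)) := by
  -- `s / 32` minimises the Chernoff exponent `16 t² - t s`.
  set t := s / 32 with ht
  have ht_abs : |t| ≤ 1 / 2 := by rw [abs_of_nonneg (by positivity)]; linarith
  have h_indep' : iIndepFun (fun i ω => Z i ω - ∫ ω, Z i ω ∂P) P :=
    h_indep.comp (fun i z => z - ∫ ω, Z i ω ∂P) fun _ => by fun_prop
  have h_meas : ∀ i, AEMeasurable (fun ω => Z i ω - ∫ ω, Z i ω ∂P) P := fun i =>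
    (hZ i).aemeasurable.sub_const _
  have h_mgf : mgf (fun ω => ∑ i, (Z i ω - ∫ ω, Z i ω ∂P)) P t
      = ∏ i, mgf (fun ω => Z i ω - ∫ ω, Z i ω ∂P) P t := by
    rw [← h_indep'.mgf_sum₀ h_meas]
    congr 1
    ext ω
    rw [Finset.sum_apply]
  calc P.real {ω | Fintype.card ι * s ≤ ∑ i, (Z i ω - ∫ ω, Z i ω ∂P)}
      ≤ Real.exp (-t * (Fintype.card ι * s)) * ∏ i, mgf (fun ω => Z i ω - ∫ ω, Z i ω ∂P) P t := by
        rw [← h_mgf]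
        exact measure_ge_le_exp_mul_mgf _ (by positivity) (integrable_exp_mul_sum h_indep' h_meas
          fun i => (hZ i).integrable_exp_mul_sub_integral (by linarith))
    _ ≤ Real.exp (-t * (Fintype.card ι * s)) * ∏ _i : ι, Real.exp (16 * t ^ 2) := by
        gcongr with i
        · exact fun i _ => mgf_nonneg
        · exact (hZ i).mgf_sub_integral_le ht_abs
    _ = Real.exp (-(Fintype.card ι * s ^ 2 / 64)) := by
        rw [Finset.prod_const, ← Real.exp_nat_mul, ← Real.exp_add, Finset.card_univ, ht]
        ring_nf

lemma measureReal_lt_abs_sum_sub_integral_le [IsProbabilityMeasure P] {Z : ι → Ω → ℝ}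
    (h_indep : iIndepFun Z P) (hZ : ∀ i, IsUnitSubexponential (Z i) P) (hs : 0 ≤ s)
    (hs16 : s ≤ 16) :
    P.real {ω | Fintype.card ι * s < |∑ i, (Z i ω - ∫ ω, Z i ω ∂P)|}
      ≤ 2 * Real.exp (-(Fintype.card ι * s ^ 2 / 64)) := by
  have h_subset : {ω | Fintype.card ι * s < |∑ i, (Z i ω - ∫ ω, Z i ω ∂P)|}
      ⊆ {ω | Fintype.card ι * s ≤ ∑ i, (Z i ω - ∫ ω, Z i ω ∂P)}
        ∪ {ω | Fintype.card ι * s ≤ ∑ i, (-Z i ω - ∫ ω, -Z i ω ∂P)} := by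
    intro ω hω
    rw [Set.mem_ofPred_eq] at hω
    rcases lt_abs.1 hω with h | h
    · exact Or.inl h.le
    · refine Or.inr (h.le.trans_eq ?_)
      rw [← Finset.sum_neg_distrib]
      refine Finset.sum_congr rfl fun i _ => ?_
      rw [integral_neg]
      ring
  have h_upper := measureReal_le_sum_sub_integral_le h_indep hZ hs hs16
  have h_lower := measureReal_le_sum_sub_integral_le
    (h_indep.comp (fun _ z => -z) fun _ => by fun_prop) (fun i => (hZ i).neg) hs hs16
  refine (measureReal_mono h_subset).trans ((measureReal_union_le _ _).trans ?_)
  rw [two_mul]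
  exact add_le_add h_upper h_lower

end SubexponentialVariables

section ProductsOfSubgaussians

variable {Ω ι : Type*} [MeasurableSpace Ω] [Fintype ι] {P : Measure Ω} {α β r : ℝ}

lemma lintegral_ofReal_exp_sq_div_four_gaussianReal :
    ∫⁻ g, ENNReal.ofReal (Real.exp (g ^ 2 / 4)) ∂(gaussianReal 0 1) = ENNReal.ofReal √2 := by
  rw [gaussianReal_of_var_ne_zero _ one_ne_zero,
    lintegral_withDensity_eq_lintegral_mul _ (measurable_gaussianPDF 0 1) (by fun_prop)]
  have h_density : ∀ g : ℝ, (gaussianPDF 0 1 * fun g => ENNReal.ofReal (Real.exp (g ^ 2 / 4))) g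
      = ENNReal.ofReal ((√(2 * Real.pi))⁻¹ * Real.exp (-(1 / 4) * g ^ 2)) := by
    intro g
    rw [Pi.mul_apply, gaussianPDF, ← ENNReal.ofReal_mul (gaussianPDFReal_nonneg _ _ _),
      gaussianPDFReal, mul_assoc, ← Real.exp_add]
    simp only [NNReal.coe_one, mul_one, sub_zero]
    ring_nf
  simp_rw [h_density]
  rw [← ofReal_integral_eq_lintegral_ofReal
    ((integrable_exp_neg_mul_sq (by norm_num)).const_mul _) (ae_of_all _ fun x => by positivity),
    integral_const_mul, integral_gaussian, ← Real.sqrt_inv, ← Real.sqrt_mul (by positivity)]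
  congr 2
  field_simp
  norm_num

lemma lintegral_ofReal_exp_mul_gaussianReal (t : ℝ) :
    ∫⁻ g, ENNReal.ofReal (Real.exp (t * g)) ∂(gaussianReal 0 1)
      = ENNReal.ofReal (Real.exp (t ^ 2 / 2)) := by
  rw [← ofReal_integral_eq_lintegral_ofReal (integrable_exp_mul_gaussianReal _)
    (ae_of_all _ fun x => by positivity)]
  congr 1
  simpa [mgf] using congrFun (mgf_fun_id_gaussianReal (μ := 0) (v := 1)) t

-- `exp (U² / (4 α²))` is the moment generating function of a standard normal `g` at
-- `U / (√2 α)`; exchanging the two expectations leaves at most `𝔼 exp (g² / 4) = √2`.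
lemma lintegral_ofReal_exp_sq_le [IsProbabilityMeasure P] {U : Ω → ℝ} (hα : 0 < α)
    (hU : HasSubgaussianMGF U (α ^ 2).toNNReal P) :
    ∫⁻ ω, ENNReal.ofReal (Real.exp (U ω ^ 2 / (4 * α ^ 2))) ∂P ≤ ENNReal.ofReal √2 := by
  have h_gauss : ∀ ω, ENNReal.ofReal (Real.exp (U ω ^ 2 / (4 * α ^ 2))) =
      ∫⁻ g, ENNReal.ofReal (Real.exp (g / (√2 * α) * U ω)) ∂(gaussianReal 0 1) := by
    intro ω
    simp only [div_mul_comm _ _ (U ω)]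
    rw [lintegral_ofReal_exp_mul_gaussianReal, div_pow, mul_pow, Real.sq_sqrt zero_le_two]
    ring_nf
  have h_mgf : ∀ g : ℝ, ∫⁻ ω, ENNReal.ofReal (Real.exp (g / (√2 * α) * U ω)) ∂P
      ≤ ENNReal.ofReal (Real.exp (g ^ 2 / 4)) := by
    intro g
    rw [← ofReal_integral_eq_lintegral_ofReal (hU.integrable_exp_mul _)
      (ae_of_all _ fun x => by positivity)]
    refine ENNReal.ofReal_le_ofReal ((hU.mgf_le _).trans_eq ?_)
    rw [div_pow, mul_pow, Real.sq_sqrt zero_le_two, Real.coe_toNNReal _ (by positivity)]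
    congr 1
    field_simp
    ring
  have h_meas : AEMeasurable (Function.uncurry fun ω (g : ℝ) =>
      ENNReal.ofReal (Real.exp (g / (√2 * α) * U ω))) (P.prod (gaussianReal 0 1)) :=
    ((measurable_snd.div_const _).aemeasurable.mul (hU.aemeasurable.comp_quasiMeasurePreserving
      Measure.quasiMeasurePreserving_fst)).exp.ennreal_ofReal
  simp_rw [h_gauss]
  rw [lintegral_lintegral_swap h_meas]
  exact (lintegral_mono h_mgf).trans_eq lintegral_ofReal_exp_sq_div_four_gaussianReal

lemma integrable_exp_sq [IsProbabilityMeasure P] {U : Ω → ℝ} (hα : 0 < α)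
    (hU : HasSubgaussianMGF U (α ^ 2).toNNReal P) :
    Integrable (fun ω => Real.exp (U ω ^ 2 / (4 * α ^ 2))) P := by
  refine ⟨((hU.aemeasurable.pow_const 2).div_const _).exp.aestronglyMeasurable, ?_⟩
  rw [hasFiniteIntegral_iff_ofReal (ae_of_all _ fun ω => by positivity)]
  exact (lintegral_ofReal_exp_sq_le hα hU).trans_lt ENNReal.ofReal_lt_top

lemma integral_exp_sq_le [IsProbabilityMeasure P] {U : Ω → ℝ} (hα : 0 < α)
    (hU : HasSubgaussianMGF U (α ^ 2).toNNReal P) :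
    ∫ ω, Real.exp (U ω ^ 2 / (4 * α ^ 2)) ∂P ≤ √2 := by
  rw [integral_eq_lintegral_of_nonneg_ae (ae_of_all _ fun ω => by positivity)
    (integrable_exp_sq hα hU).1]
  exact ENNReal.toReal_le_of_le_ofReal (by positivity) (lintegral_ofReal_exp_sq_le hα hU)

lemma exp_abs_mul_le (a b : ℝ) :
    Real.exp |a * b| ≤ 1 / 2 * Real.exp (a ^ 2) + 1 / 2 * Real.exp (b ^ 2) := by
  have h_amgm : |a * b| ≤ 1 / 2 * a ^ 2 + 1 / 2 * b ^ 2 := by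
    rw [abs_le]
    constructor <;> nlinarith [sq_nonneg (a - b), sq_nonneg (a + b)]
  exact (Real.exp_le_exp.2 h_amgm).trans <|
    convexOn_exp.2 (Set.mem_univ _) (Set.mem_univ _) (by norm_num) (by norm_num) (by norm_num)

lemma isUnitSubexponential_mul_div [IsProbabilityMeasure P] {U V : Ω → ℝ} (hα : 0 < α)
    (hβ : 0 < β) (hU : HasSubgaussianMGF U (α ^ 2).toNNReal P)
    (hV : HasSubgaussianMGF V (β ^ 2).toNNReal P) :
    IsUnitSubexponential (fun ω => U ω * V ω / (4 * α * β)) P := by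
  have h_meas : AEMeasurable (fun ω => U ω * V ω / (4 * α * β)) P :=
    (hU.aemeasurable.mul hV.aemeasurable).div_const _
  have h_le : ∀ ω, Real.exp |U ω * V ω / (4 * α * β)| ≤
      1 / 2 * Real.exp (U ω ^ 2 / (4 * α ^ 2)) + 1 / 2 * Real.exp (V ω ^ 2 / (4 * β ^ 2)) := by
    intro ω
    convert exp_abs_mul_le (U ω / (2 * α)) (V ω / (2 * β)) using 3 <;> ring_nf
  have h_int := ((integrable_exp_sq hα hU).const_mul (1 / 2)).add
    ((integrable_exp_sq hβ hV).const_mul (1 / 2))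
  have h_exp : Integrable (fun ω => Real.exp |U ω * V ω / (4 * α * β)|) P := by
    refine h_int.mono' h_meas.abs.exp.aestronglyMeasurable (ae_of_all _ fun ω => ?_)
    rw [Real.norm_eq_abs, Real.abs_exp]
    exact h_le ω
  refine ⟨h_meas, h_exp, (integral_mono h_exp h_int h_le).trans ?_⟩
  simp only [Pi.add_apply]
  rw [integral_add ((integrable_exp_sq hα hU).const_mul _) ((integrable_exp_sq hβ hV).const_mul _),
    integral_const_mul, integral_const_mul]
  have h_sqrt : √2 ≤ (2 : ℝ) := Real.sqrt_le_iff.2 ⟨zero_le_two, by norm_num⟩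
  linarith [integral_exp_sq_le hα hU, integral_exp_sq_le hβ hV]

lemma measureReal_lt_abs_average_mul_sub_le [Nonempty ι] [IsProbabilityMeasure P]
    {U V : ι → Ω → ℝ} {m : ℝ} (hα : 0 < α) (hβ : 0 < β)
    (h_indep : iIndepFun (fun i ω => U i ω * V i ω) P)
    (hU : ∀ i, HasSubgaussianMGF (U i) (α ^ 2).toNNReal P)
    (hV : ∀ i, HasSubgaussianMGF (V i) (β ^ 2).toNNReal P)
    (hm : ∀ i, ∫ ω, U i ω * V i ω ∂P = m) (hr : 0 ≤ r) (hr1 : r ≤ 1) :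
    P.real {ω | 64 * α * β * r < |1 / (Fintype.card ι : ℝ) * ∑ i, U i ω * V i ω - m|}
      ≤ 2 * Real.exp (-(4 * (Fintype.card ι * r ^ 2))) := by
  have h_card : (0 : ℝ) < Fintype.card ι := by exact_mod_cast Fintype.card_pos
  have h_bound := measureReal_lt_abs_sum_sub_integral_le (s := 16 * r)
    (h_indep.comp (fun _ z => z / (4 * α * β)) fun _ => by fun_prop)
    (fun i => isUnitSubexponential_mul_div hα hβ (hU i) (hV i)) (by positivity) (by linarith)
  have h_sum : ∀ ω, ∑ i, (U i ω * V i ω / (4 * α * β) - ∫ ω, U i ω * V i ω / (4 * α * β) ∂P)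
      = Fintype.card ι / (4 * α * β)
        * (1 / (Fintype.card ι : ℝ) * ∑ i, U i ω * V i ω - m) := by
    intro ω
    simp only [integral_div, hm, ← sub_div]
    rw [← Finset.sum_div, Finset.sum_sub_distrib, Finset.sum_const, Finset.card_univ, nsmul_eq_mul]
    field_simp
  have h_iff : ∀ x : ℝ, Fintype.card ι * (16 * r) < |Fintype.card ι / (4 * α * β) * x|
      ↔ 64 * α * β * r < |x| := by
    intro x
    rw [abs_mul, abs_of_pos (by positivity), div_mul_eq_mul_div, lt_div_iff₀ (by positivity),
      mul_assoc, mul_lt_mul_iff_right₀ h_card]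
    ring_nf
  simp only [Function.comp_def, h_sum, h_iff] at h_bound
  convert h_bound using 3
  ring

end ProductsOfSubgaussians

section GaussianNoise

variable {Ω : Type*} [MeasurableSpace Ω] {P : Measure Ω}

lemma hasSubgaussianMGF_of_hasLaw_gaussianReal {W : Ω → ℝ} {v : NNReal}
    (hW : HasLaw W (gaussianReal 0 v) P) : HasSubgaussianMGF W v P where
  integrable_exp_mul t := by
    have h := integrable_exp_mul_gaussianReal (μ := 0) (v := v) t
    rw [← hW.map_eq] at h
    exact h.comp_aemeasurable hW.aemeasurable
  mgf_le t := by rw [mgf_gaussianReal hW.map_eq, zero_mul, zero_add]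

lemma measureReal_lt_abs_le_of_hasLaw_gaussianReal {W : Ω → ℝ} {x : ℝ}
    (hW : HasLaw W (gaussianReal 0 1) P) (hx : 0 ≤ x) :
    P.real {ω | x < |W ω|} ≤ 2 * Real.exp (-(x ^ 2 / 2)) := by
  have := hW.isProbabilityMeasure
  have h_subgaussian := hasSubgaussianMGF_of_hasLaw_gaussianReal hW
  have h_subset : {ω | x < |W ω|} ⊆ {ω | x ≤ W ω} ∪ {ω | x ≤ (-W) ω} := by
    intro ω hω
    rw [Set.mem_ofPred_eq] at hω
    rcases lt_abs.1 hω with h | h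
    · exact Or.inl h.le
    · exact Or.inr h.le
  have h_upper := h_subgaussian.measure_ge_le hx
  have h_lower := h_subgaussian.neg.measure_ge_le hx
  simp only [NNReal.coe_one, mul_one, neg_div] at h_upper h_lower
  linarith [measureReal_mono (μ := P) h_subset,
    measureReal_union_le (μ := P) {ω | x ≤ W ω} {ω | x ≤ (-W) ω}]

lemma hasLaw_of_indepFun_of_forall_hasLaw [IsProbabilityMeasure P] {E F G : Type*}
    [MeasurableSpace E] [MeasurableSpace F] [MeasurableSpace G] {ν : Measure G} {Y : Ω → E}
    {Z : Ω → F} {g : E → F → G} (hY : Measurable Y) (hZ : Measurable Z) (h_indep : IndepFun Y Z P)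
    (hg : Measurable (Function.uncurry g)) (h_law : ∀ y, HasLaw (fun ω => g y (Z ω)) ν P) :
    HasLaw (fun ω => g (Y ω) (Z ω)) ν P := by
  refine ⟨(hg.comp (hY.prodMk hZ)).aemeasurable, Measure.ext fun s hs => ?_⟩
  have h_joint := (indepFun_iff_map_prod_eq_prod_map_map hY.aemeasurable hZ.aemeasurable).1 h_indep
  have h_section : ∀ y, P.map Z (Prod.mk y ⁻¹' (Function.uncurry g ⁻¹' s)) = ν s := by
    intro y
    rw [← (h_law y).map_eq, Measure.map_apply_of_aemeasurable (h_law y).aemeasurable hs,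
      Measure.map_apply hZ (measurable_prodMk_left (hg hs))]
    rfl
  have := Measure.isProbabilityMeasure_map (μ := P) hY.aemeasurable
  have := Measure.isProbabilityMeasure_map (μ := P) hZ.aemeasurable
  calc P.map (fun ω => g (Y ω) (Z ω)) s
      = P.map (fun ω => (Y ω, Z ω)) (Function.uncurry g ⁻¹' s) := by
        rw [Measure.map_apply (hY.prodMk hZ) (hg hs)]
        exact Measure.map_apply (hg.comp (hY.prodMk hZ)) hs
    _ = ν s := by
        rw [h_joint, Measure.prod_apply (hg hs)]
        simp only [h_section, lintegral_const, measure_univ, mul_one]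

namespace IsGaussianNoise

variable {N : ℕ} {σ : ℝ} {ε : Ω → Fin N → ℝ}

lemma hasLaw_apply (hε : IsGaussianNoise σ ε P) (i : Fin N) :
    HasLaw (fun ω => ε ω i) (gaussianReal 0 (σ ^ 2).toNNReal) P :=
  ⟨((measurable_pi_apply i).comp hε.measurable_noise).aemeasurable, hε.law i⟩

lemma hasSubgaussianMGF (hε : IsGaussianNoise σ ε P) (i : Fin N) :
    HasSubgaussianMGF (fun ω => ε ω i) (σ ^ 2).toNNReal P :=
  hasSubgaussianMGF_of_hasLaw_gaussianReal (hε.hasLaw_apply i)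

lemma integral_apply (hε : IsGaussianNoise σ ε P) (i : Fin N) : ∫ ω, ε ω i ∂P = 0 := by
  rw [(hε.hasLaw_apply i).integral_eq, integral_id_gaussianReal]

lemma variance_apply (hε : IsGaussianNoise σ ε P) (i : Fin N) :
    variance (fun ω => ε ω i) P = σ ^ 2 := by
  rw [(hε.hasLaw_apply i).variance_eq, variance_id_gaussianReal,
    Real.coe_toNNReal _ (sq_nonneg σ)]

lemma integral_mul_self (hε : IsGaussianNoise σ ε P) (i : Fin N) :
    ∫ ω, ε ω i * ε ω i ∂P = σ ^ 2 := by
  rw [← hε.variance_apply i, variance_of_integral_eq_zero (hε.hasLaw_apply i).aemeasurable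
    (hε.integral_apply i)]
  simp only [sq]

lemma hasLaw_dotProduct (hε : IsGaussianNoise σ ε P) (a : Fin N → ℝ) :
    HasLaw (fun ω => a ⬝ᵥ ε ω) (gaussianReal 0 (a ⬝ᵥ a * σ ^ 2).toNNReal) P := by
  have := hε.indep.isProbabilityMeasure
  have h_term : ∀ i, HasGaussianLaw (fun ω => a i * ε ω i) P := fun i =>
    (hε.hasLaw_apply i).hasGaussianLaw.fun_smul (a i)
  have h_indep : iIndepFun (fun i ω => a i * ε ω i) P :=
    hε.indep.comp (fun i z => a i * z) fun i => by fun_prop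
  have h_gauss := h_indep.hasGaussianLaw_fun_sum h_term
  have h_mean : ∫ ω, a ⬝ᵥ ε ω ∂P = 0 := by
    simp only [dotProduct]
    rw [integral_finsetSum _ fun i _ => (h_term i).integrable]
    simp only [integral_const_mul, hε.integral_apply, mul_zero, Finset.sum_const_zero]
  have h_var : variance (fun ω => a ⬝ᵥ ε ω) P = a ⬝ᵥ a * σ ^ 2 := by
    have h_sum := IndepFun.variance_sum (s := Finset.univ) (fun i _ => (h_term i).memLp_two)
      fun i _ j _ hij => h_indep.indepFun hij
    rw [Finset.sum_fn] at h_sum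
    simp only [dotProduct]
    rw [h_sum, Finset.sum_mul]
    simp only [variance_const_mul, hε.variance_apply, sq]
  refine ⟨h_gauss.aemeasurable, ?_⟩
  rw [← h_var, ← h_mean]
  exact h_gauss.map_eq_gaussianReal

lemma hasLaw_dotProduct_div_of_indepFun {E : Type*} [MeasurableSpace E] {Y : Ω → E}
    {a : E → Fin N → ℝ} (hε : IsGaussianNoise σ ε P) (hσ : σ ≠ 0) (hY : Measurable Y)
    (h_indep : IndepFun Y ε P) (ha : Measurable a) (ha_unit : ∀ y, a y ⬝ᵥ a y = 1) :
    HasLaw (fun ω => a (Y ω) ⬝ᵥ ε ω / σ) (gaussianReal 0 1) P := by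
  have := hε.indep.isProbabilityMeasure
  refine hasLaw_of_indepFun_of_forall_hasLaw (g := fun y e => a y ⬝ᵥ e / σ) hY hε.measurable_noise
    h_indep (by unfold dotProduct; fun_prop) fun y => ?_
  convert gaussianReal_div_const (hε.hasLaw_dotProduct (a y)) σ using 2
  · rw [zero_div]
  · rw [ha_unit, one_mul, Real.toNNReal_of_nonneg (sq_nonneg σ)]
    refine (div_self fun h => pow_ne_zero 2 hσ ?_).symm
    exact congrArg NNReal.toReal h

end IsGaussianNoise

end GaussianNoise

section ConvergenceInDistribution

lemma integrable_lipschitz_comp {Ω : Type*} [MeasurableSpace Ω] {P : Measure Ω}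
    [IsFiniteMeasure P] {F : ℝ → ℝ} {L : NNReal} {C : ℝ} {V : Ω → ℝ} (hF : LipschitzWith L F)
    (hC : ∀ x y, dist (F x) (F y) ≤ C) (hV : AEMeasurable V P) :
    Integrable (fun ω => F (V ω)) P := by
  refine Integrable.of_bound
    (hF.continuous.measurable.comp_aemeasurable hV).aestronglyMeasurable (|F 0| + C)
    (ae_of_all _ fun ω => ?_)
  have h_osc := hC (V ω) 0
  rw [Real.dist_eq] at h_osc
  rw [Real.norm_eq_abs]
  linarith [abs_sub_abs_le_abs_sub (F (V ω)) (F 0)]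

lemma abs_integral_comp_sub_le {Ω : Type*} [MeasurableSpace Ω] {P : Measure Ω}
    [IsProbabilityMeasure P] {F : ℝ → ℝ} {L : NNReal} {C η : ℝ} {V W : Ω → ℝ}
    (hF : LipschitzWith L F) (hC : ∀ x y, dist (F x) (F y) ≤ C) (hV : AEMeasurable V P)
    (hW : AEMeasurable W P) :
    |∫ ω, F (V ω) ∂P - ∫ ω, F (W ω) ∂P| ≤ L * |η| + C * P.real {ω | η < |V ω - W ω|} := by
  set A := {ω | η < |V ω - W ω|} with hA
  have hA_meas : NullMeasurableSet A P := nullMeasurableSet_lt aemeasurable_const (hV.sub hW).abs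
  have hA_int : Integrable (A.indicator fun _ => C) P := (integrable_const C).indicator₀ hA_meas
  have h_pointwise : ∀ ω, ‖F (V ω) - F (W ω)‖ ≤ L * |η| + A.indicator (fun _ => C) ω := by
    intro ω
    rw [← dist_eq_norm]
    by_cases hω : ω ∈ A
    · rw [Set.indicator_of_mem hω]
      exact (hC _ _).trans (le_add_of_nonneg_left (by positivity))
    · rw [Set.indicator_of_notMem hω, add_zero]
      rw [hA, Set.mem_ofPred_eq, not_lt] at hω
      refine (hF.dist_le_mul _ _).trans ?_
      rw [Real.dist_eq]
      exact mul_le_mul_of_nonneg_left (hω.trans (le_abs_self _)) L.coe_nonneg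
  have h_int := (integrable_lipschitz_comp hF hC hV).sub (integrable_lipschitz_comp hF hC hW)
  calc |∫ ω, F (V ω) ∂P - ∫ ω, F (W ω) ∂P|
      = ‖∫ ω, (F (V ω) - F (W ω)) ∂P‖ := by
        rw [integral_sub (integrable_lipschitz_comp hF hC hV) (integrable_lipschitz_comp hF hC hW),
          Real.norm_eq_abs]
    _ ≤ ∫ ω, ‖F (V ω) - F (W ω)‖ ∂P := norm_integral_le_integral_norm _
    _ ≤ ∫ ω, (L * |η| + A.indicator (fun _ => C) ω) ∂P :=
        integral_mono h_int.norm ((integrable_const _).add hA_int) h_pointwise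
    _ = L * |η| + C * P.real A := by
        rw [integral_add (integrable_const _) hA_int, integral_indicator₀ hA_meas,
          integral_const, setIntegral_const, probReal_univ, one_smul, smul_eq_mul, mul_comm C]

-- Mathlib's Slutsky lemma needs a single probability space; here it changes along the sequence.
lemma tendstoInDistribution_of_hasLaw_of_close {ι : Type*} {l : Filter ι}
    [l.IsCountablyGenerated] {Ω : ι → Type*}
    [∀ t, MeasurableSpace (Ω t)] {P : ∀ t, Measure (Ω t)} [∀ t, IsProbabilityMeasure (P t)]
    {ν : Measure ℝ} [IsProbabilityMeasure ν] {T W : ∀ t, Ω t → ℝ} {η : ι → ℝ}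
    (hT : ∀ t, AEMeasurable (T t) (P t)) (hW : ∀ t, HasLaw (W t) ν (P t))
    (hη : Tendsto η l (𝓝 0))
    (h_close : Tendsto (fun t => (P t).real {ω | η t < |T t ω - W t ω|}) l (𝓝 0)) :
    TendstoInDistribution T l (id : ℝ → ℝ) P ν := by
  refine ⟨hT, by fun_prop, tendsto_iff_forall_lipschitz_integral_tendsto.2 ?_⟩
  rintro F ⟨C, hC⟩ ⟨L, hF⟩
  have hF_meas := hF.continuous.measurable
  have h_bound : Tendsto (fun t => L * |η t| + C * (P t).real {ω | η t < |T t ω - W t ω|}) l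
      (𝓝 0) := by
    simpa using (hη.abs.const_mul (L : ℝ)).add (h_close.const_mul C)
  simp only [ProbabilityMeasure.coe_mk, Measure.map_id]
  rw [tendsto_iff_dist_tendsto_zero]
  refine squeeze_zero (fun t => dist_nonneg) (fun t => ?_) h_bound
  rw [Real.dist_eq, integral_map (hT t) hF_meas.aestronglyMeasurable, ← (hW t).map_eq,
    integral_map (hW t).aemeasurable hF_meas.aestronglyMeasurable]
  exact abs_integral_comp_sub_le hF hC (hT t) (hW t).aemeasurable

end ConvergenceInDistribution

section TwoSidedTests

lemma cdf_gaussianReal_neg (z : ℝ) :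
    cdf (gaussianReal 0 1) (-z) = 1 - cdf (gaussianReal 0 1) z := by
  have := nullSingletonClass_gaussianReal (μ := 0) one_ne_zero
  have h_neg := gaussianReal_map_neg (μ := 0) (v := 1)
  rw [neg_zero] at h_neg
  calc cdf (gaussianReal 0 1) (-z) = ((gaussianReal 0 1).map fun x => -x).real (Set.Iic (-z)) := by
        rw [h_neg, cdf_eq_real]
    _ = (gaussianReal 0 1).real (Set.Ici z) := by
        rw [map_measureReal_apply measurable_neg measurableSet_Iic]
        simp only [Set.neg_preimage, Set.neg_Iic, neg_neg]
    _ = (gaussianReal 0 1).real (Set.Iic z)ᶜ := by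
        rw [Set.compl_Iic]
        exact (measureReal_congr Ioi_ae_eq_Ici).symm
    _ = 1 - cdf (gaussianReal 0 1) z := by
        rw [probReal_compl_eq_one_sub measurableSet_Iic, cdf_eq_real]

lemma nonneg_of_half_lt_cdf_gaussianReal {z : ℝ} (hz : 1 / 2 < cdf (gaussianReal 0 1) z) :
    0 ≤ z := by
  by_contra! h_neg
  have h_mono := monotone_cdf (gaussianReal 0 1) (by linarith : z ≤ -z)
  rw [cdf_gaussianReal_neg] at h_mono
  linarith

lemma measureReal_lt_abs_gaussianReal {z : ℝ} (hz : 0 ≤ z) :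
    (gaussianReal 0 1).real {x | z < |x|} = 2 * (1 - cdf (gaussianReal 0 1) z) := by
  have := nullSingletonClass_gaussianReal (μ := 0) one_ne_zero
  have h_union : {x : ℝ | z < |x|} = Set.Iio (-z) ∪ (Set.Iic z)ᶜ := by
    ext x
    rw [Set.mem_ofPred_eq, Set.mem_union, Set.mem_Iio, Set.compl_Iic, Set.mem_Ioi, lt_abs, lt_neg,
      or_comm]
  have h_disj : Disjoint (Set.Iio (-z)) (Set.Iic z)ᶜ :=
    Set.disjoint_compl_right_iff_subset.2 fun x (hx : x < -z) => hx.le.trans (by linarith)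
  rw [h_union, measureReal_union h_disj measurableSet_Iic.compl,
    measureReal_congr Iio_ae_eq_Iic, ← cdf_eq_real, cdf_gaussianReal_neg,
    probReal_compl_eq_one_sub measurableSet_Iic, ← cdf_eq_real, two_mul]

lemma gaussianReal_frontier_lt_abs (z : ℝ) :
    gaussianReal 0 1 (frontier {x : ℝ | z < |x|}) = 0 := by
  have := nullSingletonClass_gaussianReal (μ := 0) one_ne_zero
  have h_subset : frontier {x : ℝ | z < |x|} ⊆ {z, -z} := fun x hx =>
    eq_or_eq_neg_of_abs_eq (frontier_lt_subset_eq continuous_const continuous_abs hx).symm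
  exact measure_mono_null h_subset ((Set.toFinite _).measure_zero _)

lemma tendsto_measureReal_lt_abs {Ω : ℕ → Type*} [∀ t, MeasurableSpace (Ω t)]
    {P : ∀ t, Measure (Ω t)} [∀ t, IsProbabilityMeasure (P t)] {T : ∀ t, Ω t → ℝ} {α z : ℝ}
    (hT : TendstoInDistribution T atTop (id : ℝ → ℝ) P (gaussianReal 0 1)) (hα : α < 1)
    (hz : cdf (gaussianReal 0 1) z = 1 - α / 2) :
    Tendsto (fun t => (P t).real {ω | z < |T t ω|}) atTop (𝓝 α) := by
  have h_open : IsOpen {x : ℝ | z < |x|} := isOpen_lt continuous_const continuous_abs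
  have h_limit : (gaussianReal 0 1).real {x | z < |x|} = α := by
    rw [measureReal_lt_abs_gaussianReal (nonneg_of_half_lt_cdf_gaussianReal (by linarith)), hz]
    ring
  have h_weak := ProbabilityMeasure.tendsto_measure_of_null_frontier_of_tendsto' hT.tendsto
    (E := {x : ℝ | z < |x|}) (by
      simpa only [ProbabilityMeasure.coe_mk, Measure.map_id] using gaussianReal_frontier_lt_abs z)
  simp only [ProbabilityMeasure.coe_mk, Measure.map_id] at h_weak
  rw [← h_limit]
  refine ((ENNReal.tendsto_toReal (measure_ne_top _ _)).comp h_weak).congr fun t => ?_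
  rw [Function.comp_apply,
    Measure.map_apply_of_aemeasurable (hT.forall_aemeasurable t) h_open.measurableSet]
  rfl

end TwoSidedTests

section DotProducts

variable {ι κ : Type*} [Fintype ι] [Fintype κ]

lemma dotProduct_self_nonneg (a : ι → ℝ) : 0 ≤ a ⬝ᵥ a := by
  simpa only [star_trivial] using dotProduct_self_star_nonneg a

lemma dotProduct_sq_le (a b : ι → ℝ) : (a ⬝ᵥ b) ^ 2 ≤ (a ⬝ᵥ a) * (b ⬝ᵥ b) := by
  simpa only [dotProduct, sq] using Finset.sum_mul_sq_le_sq_mul_sq Finset.univ a b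

lemma sqrt_dotProduct_self_eq_norm_toLp (v : ι → ℝ) : √(v ⬝ᵥ v) = ‖WithLp.toLp 2 v‖ := by
  simp only [EuclideanSpace.norm_eq, dotProduct, Real.norm_eq_abs, sq_abs, ← sq]

lemma abs_sqrt_sub_sqrt_le (a b : ι → ℝ) :
    |√((a - b) ⬝ᵥ (a - b)) - √(a ⬝ᵥ a)| ≤ √(b ⬝ᵥ b) := by
  simp only [sqrt_dotProduct_self_eq_norm_toLp, WithLp.toLp_sub]
  simpa using abs_norm_sub_norm_le (WithLp.toLp 2 a - WithLp.toLp 2 b) (WithLp.toLp 2 a)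

lemma abs_dotProduct_le {v : ι → ℝ} {η : ℝ} (hv : ∀ i, |v i| ≤ η) (f : ι → ℝ) :
    |f ⬝ᵥ v| ≤ η * ∑ i, |f i| := by
  rw [Finset.mul_sum]
  refine (Finset.abs_sum_le_sum_abs _ _).trans (Finset.sum_le_sum fun i _ => ?_)
  rw [abs_mul, mul_comm]
  exact mul_le_mul_of_nonneg_right (hv i) (abs_nonneg _)

lemma abs_dotProduct_mulVec_le {A : Matrix ι κ ℝ} {η : ℝ} (hA : ∀ i j, |A i j| ≤ η)
    (f : ι → ℝ) (h : κ → ℝ) : |f ⬝ᵥ (A *ᵥ h)| ≤ η * (∑ i, |f i|) * ∑ j, |h j| := by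
  have h_entry : ∀ i, |(A *ᵥ h) i| ≤ η * ∑ j, |h j| := fun i => by
    rw [mulVec, dotProduct_comm]
    exact abs_dotProduct_le (hA i) h
  calc |f ⬝ᵥ (A *ᵥ h)| ≤ η * (∑ j, |h j|) * ∑ i, |f i| := abs_dotProduct_le h_entry f
    _ = η * (∑ i, |f i|) * ∑ j, |h j| := by ring

lemma sq_mul_dotProduct_self_le {c : ℝ} {w v : ι → ℝ} (hc : 0 ≤ c)
    (h : c * (w ⬝ᵥ w) ≤ w ⬝ᵥ v) : c ^ 2 * (w ⬝ᵥ w) ≤ v ⬝ᵥ v := by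
  have h_sq := dotProduct_self_nonneg (v - c • w)
  simp only [sub_dotProduct, dotProduct_sub, smul_dotProduct, dotProduct_smul, smul_eq_mul,
    dotProduct_comm v w] at h_sq
  nlinarith

lemma transpose_mulVec_dotProduct_self_le {A : Matrix ι κ ℝ} {b : ℝ} (hb : 0 ≤ b)
    (hA : ∀ h, (A *ᵥ h) ⬝ᵥ (A *ᵥ h) ≤ b * (h ⬝ᵥ h)) (g : ι → ℝ) :
    (Aᵀ *ᵥ g) ⬝ᵥ (Aᵀ *ᵥ g) ≤ b * (g ⬝ᵥ g) := by
  set w := Aᵀ *ᵥ g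
  have h_adjoint : w ⬝ᵥ w = g ⬝ᵥ (A *ᵥ w) := dotProduct_transpose_mulVec A w g
  rcases (dotProduct_self_nonneg w).eq_or_lt with h_zero | h_pos
  · rw [← h_zero]
    exact mul_nonneg hb (dotProduct_self_nonneg g)
  · refine le_of_mul_le_mul_right ?_ h_pos
    calc (w ⬝ᵥ w) * (w ⬝ᵥ w) = (g ⬝ᵥ (A *ᵥ w)) ^ 2 := by rw [← h_adjoint, sq]
      _ ≤ (g ⬝ᵥ g) * ((A *ᵥ w) ⬝ᵥ (A *ᵥ w)) := dotProduct_sq_le _ _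
      _ ≤ (g ⬝ᵥ g) * (b * (w ⬝ᵥ w)) :=
        mul_le_mul_of_nonneg_left (hA w) (dotProduct_self_nonneg g)
      _ = b * (g ⬝ᵥ g) * (w ⬝ᵥ w) := by ring

end DotProducts

section SpectralBounds

variable {n : ℕ} {S : Matrix (Fin n) (Fin n) ℝ} {c : ℝ}

lemma dotProduct_algebraMap_mulVec (c : ℝ) (h : Fin n → ℝ) :
    h ⬝ᵥ (algebraMap ℝ (Matrix (Fin n) (Fin n) ℝ) c *ᵥ h) = c * (h ⬝ᵥ h) := by
  rw [Algebra.algebraMap_eq_smul_one, smul_mulVec, one_mulVec, dotProduct_smul, smul_eq_mul]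

open scoped MatrixOrder in
lemma mul_dotProduct_self_le_of_spectrum (hS : S.IsHermitian) (hc : ∀ x ∈ spectrum ℝ S, c ≤ x)
    (h : Fin n → ℝ) : c * (h ⬝ᵥ h) ≤ h ⬝ᵥ (S *ᵥ h) := by
  have h_psd := Matrix.le_iff.1 ((algebraMap_le_iff_le_spectrum (ha := hS)).2 hc)
  have h_nonneg := h_psd.dotProduct_mulVec_nonneg h
  rw [star_trivial, sub_mulVec, dotProduct_sub, dotProduct_algebraMap_mulVec] at h_nonneg
  linarith

open scoped MatrixOrder in
lemma dotProduct_mulVec_le_of_spectrum (hS : S.IsHermitian) (hc : ∀ x ∈ spectrum ℝ S, x ≤ c)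
    (h : Fin n → ℝ) : h ⬝ᵥ (S *ᵥ h) ≤ c * (h ⬝ᵥ h) := by
  have h_psd := Matrix.le_iff.1 ((le_algebraMap_iff_spectrum_le (ha := hS)).2 hc)
  have h_nonneg := h_psd.dotProduct_mulVec_nonneg h
  rw [star_trivial, sub_mulVec, dotProduct_sub, dotProduct_algebraMap_mulVec] at h_nonneg
  linarith

lemma inv_mul_of_spectrum_pos (hc : ∀ x ∈ spectrum ℝ S, 0 < x) : S⁻¹ * S = 1 := by
  have h_unit : IsUnit S := (spectrum.zero_notMem_iff ℝ).1 fun h => (hc 0 h).false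
  exact nonsing_inv_mul S ((isUnit_iff_isUnit_det S).1 h_unit)

lemma inv_row_dotProduct_self_le (hc₀ : 0 < c) (hS : S.IsHermitian)
    (hc : ∀ x ∈ spectrum ℝ S, c ≤ x) (a : Fin n) : S⁻¹ a ⬝ᵥ S⁻¹ a ≤ (1 / c) ^ 2 := by
  have h_symm : Sᵀ = S := by simpa only [conjTranspose_eq_transpose_of_trivial] using hS.eq
  have h_mulVec : S *ᵥ S⁻¹ a = Pi.single a 1 := by
    have h_row := congrFun (inv_mul_of_spectrum_pos fun x hx => hc₀.trans_le (hc x hx)) a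
    rw [← vecMul_transpose, h_symm]
    exact h_row.trans (funext fun _ => one_eq_pi_single)
  have h_bound := sq_mul_dotProduct_self_le hc₀.le
    (mul_dotProduct_self_le_of_spectrum hS hc (S⁻¹ a))
  rw [h_mulVec, single_dotProduct, Pi.single_eq_same, one_mul] at h_bound
  rw [div_pow, one_pow, le_div_iff₀' (by positivity)]
  exact h_bound

end SpectralBounds

section GraphDifferences

variable {n : ℕ} (G : SimpleGraph (Fin n))

lemma incidence_eq_single_sub_single (e : Edge G) :
    incidence G e = Pi.single e.1.2 1 - Pi.single e.1.1 1 := by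
  have h_ne : e.1.1 ≠ e.1.2 := e.2.1.ne
  ext v
  rw [incidence, Matrix.of_apply, Pi.sub_apply, Pi.single_apply, Pi.single_apply]
  by_cases h : v = e.1.1
  · simp [h, h_ne]
  · simp [h]

lemma incidence_dotProduct (e : Edge G) (h : Fin n → ℝ) :
    incidence G e ⬝ᵥ h = h e.1.2 - h e.1.1 := by
  rw [incidence_eq_single_sub_single, sub_dotProduct, single_one_dotProduct, single_one_dotProduct]

lemma incidence_dotProduct_self (e : Edge G) : incidence G e ⬝ᵥ incidence G e = 2 := by
  have h_ne : e.1.1 ≠ e.1.2 := e.2.1.ne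
  rw [incidence_dotProduct, incidence_eq_single_sub_single]
  simp only [Pi.sub_apply, Pi.single_eq_same, Pi.single_eq_of_ne h_ne,
    Pi.single_eq_of_ne h_ne.symm]
  norm_num

lemma sum_abs_incidence (e : Edge G) : ∑ v, |incidence G e v| = 2 := by
  have h_sq : ∀ v, |incidence G e v| = incidence G e v * incidence G e v := by
    intro v
    rw [incidence, Matrix.of_apply]
    split_ifs <;> norm_num
  simp only [h_sq]
  exact incidence_dotProduct_self G e

variable [DecidableRel G.Adj]

lemma sum_edge_add_eq_sum_degree_mul (φ : Fin n → ℝ) :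
    ∑ e : Edge G, (φ e.1.1 + φ e.1.2) = ∑ u, G.degree u * φ u := by
  have h_edge : ∀ ψ : Fin n × Fin n → ℝ,
      ∑ e : Edge G, ψ e.1 = ∑ u, ∑ v, if u < v ∧ G.Adj u v then ψ (u, v) else 0 := by
    intro ψ
    rw [← Fintype.sum_prod_type' (f := fun u v => if u < v ∧ G.Adj u v then ψ (u, v) else 0),
      ← Finset.sum_filter]
    exact (Finset.sum_subtype _ (fun x => by simp) ψ).symm
  rw [Finset.sum_add_distrib, h_edge fun x => φ x.1, h_edge fun x => φ x.2,
    Finset.sum_comm (f := fun u v => if u < v ∧ G.Adj u v then φ v else 0),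
    ← Finset.sum_add_distrib]
  refine Finset.sum_congr rfl fun u _ => ?_
  rw [← Finset.sum_add_distrib, ← G.card_neighborFinset_eq_degree, G.neighborFinset_eq_filter,
    ← nsmul_eq_mul, ← Finset.sum_const, Finset.sum_filter]
  refine Finset.sum_congr rfl fun v _ => ?_
  rcases lt_trichotomy u v with h | rfl | h
  · simp [h, h.not_gt]
  · simp
  · simp [h, h.not_gt, G.adj_comm v u]

lemma incidence_mulVec_dotProduct_self_le (h : Fin n → ℝ) :
    (incidence G *ᵥ h) ⬝ᵥ (incidence G *ᵥ h) ≤ 2 * G.maxDegree * (h ⬝ᵥ h) := by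
  calc (incidence G *ᵥ h) ⬝ᵥ (incidence G *ᵥ h)
      ≤ ∑ e : Edge G, (2 * h e.1.1 ^ 2 + 2 * h e.1.2 ^ 2) := by
        refine Finset.sum_le_sum fun e _ => ?_
        rw [mulVec, incidence_dotProduct]
        nlinarith [sq_nonneg (h e.1.2 + h e.1.1)]
    _ = ∑ u, G.degree u * (2 * h u ^ 2) :=
        sum_edge_add_eq_sum_degree_mul G fun u => 2 * h u ^ 2
    _ ≤ ∑ u, G.maxDegree * (2 * h u ^ 2) := by
        gcongr with u
        exact G.degree_le_maxDegree u
    _ = 2 * G.maxDegree * (h ⬝ᵥ h) := by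
        rw [dotProduct, Finset.mul_sum]
        exact Finset.sum_congr rfl fun u _ => by ring

lemma laplacian_mulVec_dotProduct_self_le (h : Fin n → ℝ) :
    (laplacian G *ᵥ h) ⬝ᵥ (laplacian G *ᵥ h) ≤ (2 * G.maxDegree) ^ 2 * (h ⬝ᵥ h) := by
  rw [laplacian, ← mulVec_mulVec]
  calc _ ≤ 2 * G.maxDegree * ((incidence G *ᵥ h) ⬝ᵥ (incidence G *ᵥ h)) :=
        transpose_mulVec_dotProduct_self_le (by positivity)
          (incidence_mulVec_dotProduct_self_le G) _
    _ ≤ 2 * G.maxDegree * (2 * G.maxDegree * (h ⬝ᵥ h)) := by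
        gcongr
        exact incidence_mulVec_dotProduct_self_le G h
    _ = (2 * G.maxDegree) ^ 2 * (h ⬝ᵥ h) := by ring

lemma graphDiff_mulVec_dotProduct_self_le : ∀ (k : ℕ) (h : Fin n → ℝ),
    (graphDiff G k *ᵥ h) ⬝ᵥ (graphDiff G k *ᵥ h) ≤ (2 * G.maxDegree) ^ (k + 1) * (h ⬝ᵥ h)
  | 0, h => by
      rw [zero_add, pow_one]
      exact incidence_mulVec_dotProduct_self_le G h
  | 1, h => laplacian_mulVec_dotProduct_self_le G h
  | k + 2, h => by
      have h_step := graphDiff_mulVec_dotProduct_self_le k (laplacian G *ᵥ h)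
      rw [mulVec_mulVec] at h_step
      refine h_step.trans ?_
      calc _ ≤ (2 * (G.maxDegree : ℝ)) ^ (k + 1) * ((2 * G.maxDegree) ^ 2 * (h ⬝ᵥ h)) := by
            gcongr
            exact laplacian_mulVec_dotProduct_self_le G h
        _ = (2 * (G.maxDegree : ℝ)) ^ (k + 2 + 1) * (h ⬝ᵥ h) := by ring

end GraphDifferences

section SparseL1

variable {ι : Type*} [Fintype ι] {a : ι → ℝ} {s : ℕ}

lemma sum_abs_sub_sum_abs_le (a b : ι → ℝ) :
    ∑ i, |a i| - ∑ i, |b i| ≤ ∑ i with a i ≠ 0, |(b - a) i| := by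
  rw [← Finset.sum_sub_distrib, Finset.sum_filter]
  refine Finset.sum_le_sum fun i _ => ?_
  split_ifs with h
  · rw [Pi.sub_apply, abs_sub_comm]
    exact abs_sub_abs_le_abs_sub _ _
  · rw [not_not.1 h, abs_zero, zero_sub]
    exact neg_nonpos.2 (abs_nonneg _)

lemma sum_abs_sub_sum_abs_add_le (a b : ι → ℝ) :
    ∑ i, |a i| - ∑ i, |b i| + ∑ i, |(b - a) i| ≤ 2 * ∑ i with a i ≠ 0, |(b - a) i| := by
  rw [← Finset.sum_sub_distrib, ← Finset.sum_add_distrib, Finset.sum_filter, Finset.mul_sum]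
  refine Finset.sum_le_sum fun i _ => ?_
  split_ifs with h
  · rw [Pi.sub_apply, abs_sub_comm (b i)]
    linarith [abs_sub_abs_le_abs_sub (a i) (b i)]
  · rw [Pi.sub_apply, not_not.1 h, abs_zero, sub_zero]
    linarith

lemma sum_abs_le_sqrt_mul_sqrt_of_hammingNorm_le (ha : hammingNorm a ≤ s) (h : ι → ℝ) :
    ∑ i with a i ≠ 0, |h i| ≤ √s * √(h ⬝ᵥ h) := by
  have h_card : (({i | a i ≠ 0} : Finset ι).card : ℝ) ≤ s := by exact_mod_cast ha
  have h_sum : ∑ i with a i ≠ 0, |h i| ^ 2 ≤ h ⬝ᵥ h := by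
    simp only [sq_abs, dotProduct, ← sq]
    exact Finset.sum_le_sum_of_subset_of_nonneg (Finset.subset_univ _) fun i _ _ => sq_nonneg _
  rw [← Real.sqrt_mul s.cast_nonneg]
  exact Real.le_sqrt_of_sq_le <| sq_sum_le_card_mul_sum_sq.trans <| by gcongr

lemma sum_abs_sub_sum_abs_le_of_hammingNorm_le (ha : hammingNorm a ≤ s) (b : ι → ℝ) :
    ∑ i, |a i| - ∑ i, |b i| ≤ √s * √((b - a) ⬝ᵥ (b - a)) :=
  (sum_abs_sub_sum_abs_le a b).trans (sum_abs_le_sqrt_mul_sqrt_of_hammingNorm_le ha _)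

lemma sum_abs_sub_sum_abs_add_le_of_hammingNorm_le (ha : hammingNorm a ≤ s) (b : ι → ℝ) :
    ∑ i, |a i| - ∑ i, |b i| + ∑ i, |(b - a) i| ≤ 2 * (√s * √((b - a) ⬝ᵥ (b - a))) := by
  linarith [sum_abs_sub_sum_abs_add_le a b,
    sum_abs_le_sqrt_mul_sqrt_of_hammingNorm_le ha (b - a)]

end SparseL1

section FusedLasso

variable {R : Type*} [Fintype R] {N n : ℕ}

/-- The objective `(2N)⁻¹ ‖y - X β‖₂² + lamD ‖D β‖₁ + lam ‖β‖₁` of the sparse fused lasso. It is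
`objective G k` when `D` is the graph difference operator `graphDiff G k`. -/
noncomputable def fusedObjective (D : Matrix R (Fin n) ℝ) (lamD lam : ℝ)
    (X : Matrix (Fin N) (Fin n) ℝ) (y : Fin N → ℝ) (β : Fin n → ℝ) : ℝ :=
  1 / (2 * (N : ℝ)) * ∑ i, (y i - (X *ᵥ β) i) ^ 2 + lamD * ∑ r, |(D *ᵥ β) r| + lam * ∑ a, |β a|

/-- `βhat` is a sparse fused lasso estimate with penalty matrix `D`. The analysis of the estimator
uses nothing about `D` beyond its operator norm, so `D` is arbitrary. -/
def IsFusedLasso (D : Matrix R (Fin n) ℝ) (lamD lam : ℝ) (X : Matrix (Fin N) (Fin n) ℝ)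
    (y : Fin N → ℝ) (βhat : Fin n → ℝ) : Prop :=
  ∀ β : Fin n → ℝ, fusedObjective D lamD lam X y βhat ≤ fusedObjective D lamD lam X y β

variable {X : Matrix (Fin N) (Fin n) ℝ}

lemma dotProduct_sampleCov_mulVec (X : Matrix (Fin N) (Fin n) ℝ) (u v : Fin n → ℝ) :
    u ⬝ᵥ (sampleCov X *ᵥ v) = 1 / N * ((X *ᵥ u) ⬝ᵥ (X *ᵥ v)) := by
  rw [sampleCov, smul_mulVec, dotProduct_smul, smul_eq_mul, ← mulVec_mulVec,
    dotProduct_transpose_mulVec, dotProduct_comm]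

lemma dotProduct_sampleCov_mulVec_self_nonneg (X : Matrix (Fin N) (Fin n) ℝ) (h : Fin n → ℝ) :
    0 ≤ h ⬝ᵥ (sampleCov X *ᵥ h) := by
  rw [dotProduct_sampleCov_mulVec]
  exact mul_nonneg (by positivity) (dotProduct_self_nonneg _)

lemma sum_sq_residual (X : Matrix (Fin N) (Fin n) ℝ) (ε : Fin N → ℝ) (βs β : Fin n → ℝ) :
    ∑ i, ((X *ᵥ βs + ε) i - (X *ᵥ β) i) ^ 2
      = (ε - X *ᵥ (β - βs)) ⬝ᵥ (ε - X *ᵥ (β - βs)) := by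
  refine Finset.sum_congr rfl fun i _ => ?_
  simp only [mulVec_sub, Pi.add_apply, Pi.sub_apply]
  ring

lemma half_mean_sq_residual (X : Matrix (Fin N) (Fin n) ℝ) (ε : Fin N → ℝ) (βs β : Fin n → ℝ) :
    1 / (2 * (N : ℝ)) * ∑ i, ((X *ᵥ βs + ε) i - (X *ᵥ β) i) ^ 2
      = 1 / (2 * (N : ℝ)) * (ε ⬝ᵥ ε) - 1 / N * (ε ⬝ᵥ (X *ᵥ (β - βs)))
        + 1 / 2 * ((β - βs) ⬝ᵥ (sampleCov X *ᵥ (β - βs))) := by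
  rw [sum_sq_residual, dotProduct_sampleCov_mulVec]
  simp only [sub_dotProduct, dotProduct_sub, dotProduct_comm _ ε]
  ring

lemma mean_noise_dotProduct_mulVec_le {ε : Fin N → ℝ} {η : ℝ}
    (h_noise : ∀ a, |1 / (N : ℝ) * (Xᵀ *ᵥ ε) a| ≤ η) (h : Fin n → ℝ) :
    1 / (N : ℝ) * (ε ⬝ᵥ (X *ᵥ h)) ≤ η * ∑ a, |h a| := by
  rw [← dotProduct_transpose_mulVec, ← smul_eq_mul, ← dotProduct_smul]
  exact (le_abs_self _).trans (abs_dotProduct_le h_noise h)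

lemma fused_penalty_sub_le {D : Matrix R (Fin n) ℝ} {lamD lam b : ℝ} {s₁ s₂ : ℕ}
    {βs : Fin n → ℝ} (hD : ∀ h, (D *ᵥ h) ⬝ᵥ (D *ᵥ h) ≤ b * (h ⬝ᵥ h)) (hb : 0 ≤ b)
    (hlamD : 0 ≤ lamD) (h_balance : lamD * √(b * s₁) ≤ lam * √s₂)
    (hβs : hammingNorm (D *ᵥ βs) ≤ s₁) (β : Fin n → ℝ) :
    lamD * (∑ r, |(D *ᵥ βs) r| - ∑ r, |(D *ᵥ β) r|)
      ≤ lam * √s₂ * √((β - βs) ⬝ᵥ (β - βs)) := by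
  have h_l1 := sum_abs_sub_sum_abs_le_of_hammingNorm_le hβs (D *ᵥ β)
  rw [← mulVec_sub] at h_l1
  calc lamD * (∑ r, |(D *ᵥ βs) r| - ∑ r, |(D *ᵥ β) r|)
      ≤ lamD * (√s₁ * √(b * ((β - βs) ⬝ᵥ (β - βs)))) := by
        gcongr
        exact h_l1.trans (by gcongr; exact hD _)
    _ = lamD * √(b * s₁) * √((β - βs) ⬝ᵥ (β - βs)) := by
        rw [Real.sqrt_mul hb, Real.sqrt_mul hb]
        ring
    _ ≤ lam * √s₂ * √((β - βs) ⬝ᵥ (β - βs)) := by gcongr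

lemma IsFusedLasso.basic_inequality {D : Matrix R (Fin n) ℝ} {lamD lam b : ℝ} {s₁ s₂ : ℕ}
    {ε : Fin N → ℝ} {βs βhat : Fin n → ℝ}
    (h_min : IsFusedLasso D lamD lam X (X *ᵥ βs + ε) βhat)
    (hD : ∀ h, (D *ᵥ h) ⬝ᵥ (D *ᵥ h) ≤ b * (h ⬝ᵥ h)) (hb : 0 ≤ b) (hlamD : 0 ≤ lamD)
    (hlam : 0 ≤ lam) (h_balance : lamD * √(b * s₁) ≤ lam * √s₂)
    (hDβs : hammingNorm (D *ᵥ βs) ≤ s₁) (hβs : hammingNorm βs ≤ s₂)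
    (h_noise : ∀ a, |1 / (N : ℝ) * (Xᵀ *ᵥ ε) a| ≤ lam / 2) :
    (βhat - βs) ⬝ᵥ (sampleCov X *ᵥ (βhat - βs)) + lam * ∑ a, |(βhat - βs) a|
      ≤ 6 * lam * √s₂ * √((βhat - βs) ⬝ᵥ (βhat - βs)) := by
  have h_obj := h_min βs
  simp only [fusedObjective, half_mean_sq_residual, sub_self, mulVec_zero, dotProduct_zero]
    at h_obj
  have h_cross := mean_noise_dotProduct_mulVec_le h_noise (βhat - βs)
  have h_fused := fused_penalty_sub_le hD hb hlamD h_balance hDβs βhat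
  have h_sparse := mul_le_mul_of_nonneg_left
    (sum_abs_sub_sum_abs_add_le_of_hammingNorm_le hβs βhat) hlam
  linarith

end FusedLasso

section RestrictedEigenvalue

variable {N n : ℕ} {S : Matrix (Fin n) (Fin n) ℝ} {X : Matrix (Fin N) (Fin n) ℝ}

lemma abs_dotProduct_sampleCov_mulVec_sub_le {η : ℝ} (hη : ∀ a b, |(sampleCov X - S) a b| ≤ η)
    (h : Fin n → ℝ) :
    |h ⬝ᵥ (sampleCov X *ᵥ h) - h ⬝ᵥ (S *ᵥ h)| ≤ η * (∑ a, |h a|) ^ 2 := by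
  rw [← dotProduct_sub, ← sub_mulVec, sq, ← mul_assoc]
  exact abs_dotProduct_mulVec_le hη h h

variable {h : Fin n → ℝ} {lam c η : ℝ} {s : ℕ}

lemma mul_dotProduct_self_le_of_cone (hS : c * (h ⬝ᵥ h) ≤ h ⬝ᵥ (S *ᵥ h))
    (hη : ∀ a b, |(sampleCov X - S) a b| ≤ η) (hη₀ : 0 ≤ η) (h_small : 36 * s * η ≤ c / 2)
    (h_cone : ∑ a, |h a| ≤ 6 * √s * √(h ⬝ᵥ h)) :
    c / 2 * (h ⬝ᵥ h) ≤ h ⬝ᵥ (sampleCov X *ᵥ h) := by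
  have h_dev : η * (∑ a, |h a|) ^ 2 ≤ c / 2 * (h ⬝ᵥ h) :=
    calc η * (∑ a, |h a|) ^ 2 ≤ η * (6 * √s * √(h ⬝ᵥ h)) ^ 2 := by gcongr
      _ = 36 * s * η * (h ⬝ᵥ h) := by
        rw [mul_pow, mul_pow, Real.sq_sqrt s.cast_nonneg, Real.sq_sqrt (dotProduct_self_nonneg h)]
        ring
      _ ≤ c / 2 * (h ⬝ᵥ h) := mul_le_mul_of_nonneg_right h_small (dotProduct_self_nonneg h)
  linarith [(abs_le.1 (abs_dotProduct_sampleCov_mulVec_sub_le hη h)).1]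

lemma error_bounds_of_basic_inequality (hlam : 0 < lam) (hc : 0 < c)
    (hS : c * (h ⬝ᵥ h) ≤ h ⬝ᵥ (S *ᵥ h)) (hη : ∀ a b, |(sampleCov X - S) a b| ≤ η)
    (hη₀ : 0 ≤ η) (h_small : 36 * s * η ≤ c / 2)
    (h_basic : h ⬝ᵥ (sampleCov X *ᵥ h) + lam * ∑ a, |h a| ≤ 6 * lam * √s * √(h ⬝ᵥ h)) :
    ∑ a, |h a| ≤ 72 * lam * s / c ∧ h ⬝ᵥ (sampleCov X *ᵥ h) ≤ 72 * lam ^ 2 * s / c := by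
  have h_cone : ∑ a, |h a| ≤ 6 * √s * √(h ⬝ᵥ h) := by
    refine le_of_mul_le_mul_left ?_ hlam
    linarith [dotProduct_sampleCov_mulVec_self_nonneg X h]
  have h_pred : h ⬝ᵥ (sampleCov X *ᵥ h) ≤ 6 * lam * √s * √(h ⬝ᵥ h) := by
    have : 0 ≤ lam * ∑ a, |h a| := by positivity
    linarith
  have h_l2 : √(h ⬝ᵥ h) ≤ 12 * lam * √s / c := by
    have h_re := mul_dotProduct_self_le_of_cone hS hη hη₀ h_small h_cone
    rcases (Real.sqrt_nonneg (h ⬝ᵥ h)).eq_or_lt with h_zero | h_pos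
    · rw [← h_zero]
      positivity
    · rw [le_div_iff₀ hc]
      refine le_of_mul_le_mul_right ?_ h_pos
      nlinarith [Real.sq_sqrt (dotProduct_self_nonneg h)]
  have h_sq : √(s : ℝ) ^ 2 = s := Real.sq_sqrt s.cast_nonneg
  constructor
  · calc ∑ a, |h a| ≤ 6 * √s * (12 * lam * √s / c) := h_cone.trans (by gcongr)
      _ = 72 * lam * √s ^ 2 / c := by ring
      _ = 72 * lam * s / c := by rw [h_sq]
  · calc h ⬝ᵥ (sampleCov X *ᵥ h) ≤ 6 * lam * √s * (12 * lam * √s / c) :=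
          h_pred.trans (by gcongr)
      _ = 72 * lam ^ 2 * √s ^ 2 / c := by ring
      _ = 72 * lam ^ 2 * s / c := by rw [h_sq]

end RestrictedEigenvalue

section Direction

variable {ι : Type*} [Fintype ι] [DecidableEq ι]

/-- The unit vector in the direction of `q`. For `q = 0` it is the basis vector of `i₀`, so that it
has length one for every `q`. -/
noncomputable def direction (i₀ : ι) (q : ι → ℝ) : ι → ℝ :=
  if q ⬝ᵥ q = 0 then Pi.single i₀ 1 else (√(q ⬝ᵥ q))⁻¹ • q

lemma direction_dotProduct_self (i₀ : ι) (q : ι → ℝ) :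
    direction i₀ q ⬝ᵥ direction i₀ q = 1 := by
  unfold direction
  split_ifs with h
  · rw [single_dotProduct, Pi.single_eq_same, one_mul]
  · rw [smul_dotProduct, dotProduct_smul, smul_smul, ← mul_inv,
      Real.mul_self_sqrt (dotProduct_self_nonneg q), smul_eq_mul, inv_mul_cancel₀ h]

lemma dotProduct_eq_sqrt_mul_direction_dotProduct (i₀ : ι) (q v : ι → ℝ) :
    q ⬝ᵥ v = √(q ⬝ᵥ q) * (direction i₀ q ⬝ᵥ v) := by
  unfold direction
  split_ifs with h
  · rw [h, Real.sqrt_zero, zero_mul, dotProduct_self_eq_zero.1 h, zero_dotProduct]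
  · have h_ne : √(q ⬝ᵥ q) ≠ 0 := (Real.sqrt_ne_zero (dotProduct_self_nonneg q)).2 h
    rw [smul_dotProduct, smul_eq_mul, mul_inv_cancel_left₀ h_ne]

lemma measurable_direction (i₀ : ι) : Measurable (direction i₀) := by
  unfold direction
  have h : Measurable fun q : ι → ℝ => q ⬝ᵥ q := by
    unfold dotProduct
    fun_prop
  exact Measurable.ite (h (measurableSet_singleton 0)) measurable_const
    (h.sqrt.inv.smul measurable_id)

end Direction

section OneStep

variable {N n : ℕ}

lemma dotProduct_oneStep_sub (X : Matrix (Fin N) (Fin n) ℝ) (ε : Fin N → ℝ) (βs βhat : Fin n → ℝ)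
    (Θ : Matrix (Fin n) (Fin n) ℝ) (f : Fin n → ℝ) :
    f ⬝ᵥ oneStep X (X *ᵥ βs + ε) βhat Θ - f ⬝ᵥ βs
      = 1 / N * ((X *ᵥ (Θᵀ *ᵥ f)) ⬝ᵥ ε) - f ⬝ᵥ ((Θ * sampleCov X - 1) *ᵥ (βhat - βs)) := by
  have h_residual : X *ᵥ βs + ε - X *ᵥ βhat = ε - X *ᵥ (βhat - βs) := by
    rw [mulVec_sub]
    abel
  have h_noise : (X *ᵥ (Θᵀ *ᵥ f)) ⬝ᵥ ε = f ⬝ᵥ ((Θ * Xᵀ) *ᵥ ε) := by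
    rw [← dotProduct_transpose_mulVec, transpose_mul, transpose_transpose, mulVec_mulVec,
      dotProduct_comm]
  have h_gram : (Θ * sampleCov X) *ᵥ (βhat - βs)
      = (1 / (N : ℝ)) • ((Θ * Xᵀ) *ᵥ (X *ᵥ (βhat - βs))) := by
    rw [sampleCov, mul_smul_comm, smul_mulVec, mulVec_mulVec, Matrix.mul_assoc]
  rw [oneStep, h_residual, h_noise, sub_mulVec, one_mulVec, h_gram, mulVec_sub _ ε]
  simp only [dotProduct_add, dotProduct_sub, dotProduct_smul, smul_eq_mul, smul_sub]
  ring

lemma dotProduct_sandwich_mulVec (X : Matrix (Fin N) (Fin n) ℝ) (Θ : Matrix (Fin n) (Fin n) ℝ)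
    (f : Fin n → ℝ) :
    f ⬝ᵥ ((Θ * sampleCov X * Θᵀ) *ᵥ f)
      = 1 / N * ((X *ᵥ (Θᵀ *ᵥ f)) ⬝ᵥ (X *ᵥ (Θᵀ *ᵥ f))) := by
  rw [← mulVec_mulVec, ← mulVec_mulVec, ← dotProduct_transpose_mulVec, dotProduct_comm,
    dotProduct_sampleCov_mulVec]

lemma dotProduct_mul_sampleCov_mulVec_sq_le (X : Matrix (Fin N) (Fin n) ℝ)
    (Θ : Matrix (Fin n) (Fin n) ℝ) (f h : Fin n → ℝ) :
    (f ⬝ᵥ ((Θ * sampleCov X) *ᵥ h)) ^ 2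
      ≤ (f ⬝ᵥ ((Θ * sampleCov X * Θᵀ) *ᵥ f)) * (h ⬝ᵥ (sampleCov X *ᵥ h)) := by
  rw [dotProduct_sandwich_mulVec, dotProduct_sampleCov_mulVec, ← mulVec_mulVec,
    ← dotProduct_transpose_mulVec, dotProduct_comm, dotProduct_sampleCov_mulVec]
  calc _ = (1 / (N : ℝ)) ^ 2 * ((X *ᵥ (Θᵀ *ᵥ f)) ⬝ᵥ (X *ᵥ h)) ^ 2 := by ring
    _ ≤ (1 / (N : ℝ)) ^ 2
        * (((X *ᵥ (Θᵀ *ᵥ f)) ⬝ᵥ (X *ᵥ (Θᵀ *ᵥ f))) * ((X *ᵥ h) ⬝ᵥ (X *ᵥ h))) := by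
      gcongr
      exact dotProduct_sq_le _ _
    _ = _ := by ring

variable {X : Matrix (Fin N) (Fin n) ℝ} {S Θ : Matrix (Fin n) (Fin n) ℝ} {f : Fin n → ℝ}
  {c η κ μ : ℝ}

lemma CLIMEFeasible.half_dotProduct_self_le (hΘ : CLIMEFeasible S μ Θ) (hμ : 0 ≤ μ)
    (hf : (∑ a, |f a|) ^ 2 ≤ κ * (f ⬝ᵥ f)) (hμκ : κ * μ ≤ 1 / 2) :
    1 / 2 * (f ⬝ᵥ f) ≤ f ⬝ᵥ ((Θ * S) *ᵥ f) := by
  have h_dev := abs_dotProduct_mulVec_le hΘ f f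
  rw [sub_mulVec, one_mulVec, dotProduct_sub, mul_assoc, ← sq] at h_dev
  have h_l1 := mul_le_mul_of_nonneg_left hf hμ
  have h_small := mul_le_mul_of_nonneg_right hμκ (dotProduct_self_nonneg f)
  linarith [(abs_le.1 h_dev).1]

lemma dotProduct_sampleCov_mulVec_le_two_mul (hS : f ⬝ᵥ (S *ᵥ f) ≤ c * (f ⬝ᵥ f))
    (hη : ∀ a b, |(sampleCov X - S) a b| ≤ η) (hη₀ : 0 ≤ η)
    (hf : (∑ a, |f a|) ^ 2 ≤ κ * (f ⬝ᵥ f)) (hηκ : κ * η ≤ c) :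
    f ⬝ᵥ (sampleCov X *ᵥ f) ≤ 2 * c * (f ⬝ᵥ f) := by
  have h_l1 := mul_le_mul_of_nonneg_left hf hη₀
  have h_small := mul_le_mul_of_nonneg_right hηκ (dotProduct_self_nonneg f)
  linarith [(abs_le.1 (abs_dotProduct_sampleCov_mulVec_sub_le hη f)).2]

lemma dotProduct_self_le_mul_sandwich (hf₀ : 0 < f ⬝ᵥ f)
    (h_upper : f ⬝ᵥ (sampleCov X *ᵥ f) ≤ 2 * c * (f ⬝ᵥ f))
    (h_lower : 1 / 2 * (f ⬝ᵥ f) ≤ f ⬝ᵥ ((Θ * sampleCov X) *ᵥ f)) :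
    f ⬝ᵥ f ≤ 8 * c * (f ⬝ᵥ ((Θ * sampleCov X * Θᵀ) *ᵥ f)) := by
  have h_variance : 0 ≤ f ⬝ᵥ ((Θ * sampleCov X * Θᵀ) *ᵥ f) := by
    rw [dotProduct_sandwich_mulVec]
    exact mul_nonneg (by positivity) (dotProduct_self_nonneg _)
  refine le_of_mul_le_mul_right ?_ hf₀
  calc f ⬝ᵥ f * (f ⬝ᵥ f) = 4 * (1 / 2 * (f ⬝ᵥ f)) ^ 2 := by ring
    _ ≤ 4 * (f ⬝ᵥ ((Θ * sampleCov X) *ᵥ f)) ^ 2 := by gcongr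
    _ ≤ 4 * ((f ⬝ᵥ ((Θ * sampleCov X * Θᵀ) *ᵥ f)) * (f ⬝ᵥ (sampleCov X *ᵥ f))) := by
      gcongr
      exact dotProduct_mul_sampleCov_mulVec_sq_le X Θ f f
    _ ≤ 4 * ((f ⬝ᵥ ((Θ * sampleCov X * Θᵀ) *ᵥ f)) * (2 * c * (f ⬝ᵥ f))) := by gcongr
    _ = 8 * c * (f ⬝ᵥ ((Θ * sampleCov X * Θᵀ) *ᵥ f)) * (f ⬝ᵥ f) := by ring

lemma CLIMEFeasible.abs_bias_le (hΘ : CLIMEFeasible S μ Θ) (hμ : 0 ≤ μ) (hκ : 0 ≤ κ)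
    (hf : (∑ a, |f a|) ^ 2 ≤ κ * (f ⬝ᵥ f)) {v : ℝ} (hc : 0 ≤ c) (hv : f ⬝ᵥ f ≤ 8 * c * v)
    (h : Fin n → ℝ) :
    |f ⬝ᵥ ((Θ * S - 1) *ᵥ h)| ≤ √(8 * c * κ) * μ * (∑ a, |h a|) * √v := by
  have h_l1 : ∑ a, |f a| ≤ √(8 * c * κ) * √v := by
    rw [← Real.sqrt_mul (by positivity)]
    refine Real.le_sqrt_of_sq_le (hf.trans ?_)
    calc κ * (f ⬝ᵥ f) ≤ κ * (8 * c * v) := by gcongr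
      _ = 8 * c * κ * v := by ring
  calc |f ⬝ᵥ ((Θ * S - 1) *ᵥ h)| ≤ μ * (∑ a, |f a|) * ∑ a, |h a| :=
        abs_dotProduct_mulVec_le hΘ f h
    _ ≤ μ * (√(8 * c * κ) * √v) * ∑ a, |h a| := by gcongr
    _ = √(8 * c * κ) * μ * (∑ a, |h a|) * √v := by ring

end OneStep

section ContrastStat

variable {N n : ℕ}

/-- For a contrast `f`, a noise level `s` and a centring `c`: the statistic
`√N (fᵀ βtilde - c) / (s √(fᵀ Θ Σ_N Θᵀ f))` of the one-step estimator `βtilde`. It is `edgeStat`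
when `f` is a row of the incidence matrix. -/
noncomputable def contrastStat (f : Fin n → ℝ) (s c : ℝ) (X : Matrix (Fin N) (Fin n) ℝ)
    (y : Fin N → ℝ) (βhat : Fin n → ℝ) (Θ : Matrix (Fin n) (Fin n) ℝ) : ℝ :=
  √(N : ℝ) * (f ⬝ᵥ oneStep X y βhat Θ - c) / (s * √(f ⬝ᵥ ((Θ * sampleCov X * Θᵀ) *ᵥ f)))

/-- The noise of the statistic `contrastStat`, standardised: the component of `ε / σ` along the unit
vector in the direction of `X Θᵀ f`. -/
noncomputable def contrastNoise (i₀ : Fin N) (f : Fin n → ℝ) (σ : ℝ)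
    (X : Matrix (Fin N) (Fin n) ℝ) (ε : Fin N → ℝ) (Θ : Matrix (Fin n) (Fin n) ℝ) : ℝ :=
  direction i₀ (X *ᵥ (Θᵀ *ᵥ f)) ⬝ᵥ ε / σ

variable {X : Matrix (Fin N) (Fin n) ℝ} {ε : Fin N → ℝ} {βs βhat f : Fin n → ℝ}
  {Θ : Matrix (Fin n) (Fin n) ℝ} {s σ c τ : ℝ}

lemma contrastStat_eq_contrastNoise_sub (i₀ : Fin N) (hσ : σ ≠ 0)
    (h_var : 0 < f ⬝ᵥ ((Θ * sampleCov X * Θᵀ) *ᵥ f)) :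
    contrastStat f σ (f ⬝ᵥ βs) X (X *ᵥ βs + ε) βhat Θ
      = contrastNoise i₀ f σ X ε Θ
        - √N * (f ⬝ᵥ ((Θ * sampleCov X - 1) *ᵥ (βhat - βs)))
          / (σ * √(f ⬝ᵥ ((Θ * sampleCov X * Θᵀ) *ᵥ f))) := by
  have hN : (0 : ℝ) < N := by exact_mod_cast i₀.pos
  have h_norm : √((X *ᵥ (Θᵀ *ᵥ f)) ⬝ᵥ (X *ᵥ (Θᵀ *ᵥ f)))
      = √N * √(f ⬝ᵥ ((Θ * sampleCov X * Θᵀ) *ᵥ f)) := by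
    rw [← Real.sqrt_mul hN.le, dotProduct_sandwich_mulVec, one_div, mul_inv_cancel_left₀ hN.ne']
  rw [contrastStat, contrastNoise, dotProduct_oneStep_sub,
    dotProduct_eq_sqrt_mul_direction_dotProduct i₀, h_norm]
  have h_sqrt : √(N : ℝ) * √(N : ℝ) = N := Real.mul_self_sqrt hN.le
  field_simp [(Real.sqrt_pos.2 h_var).ne']
  linear_combination (√(f ⬝ᵥ ((Θ * sampleCov X * Θᵀ) *ᵥ f))
    * (direction i₀ (X *ᵥ (Θᵀ *ᵥ f)) ⬝ᵥ ε)) * h_sqrt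

lemma abs_contrastStat_sub_contrastNoise_le {S : Matrix (Fin n) (Fin n) ℝ} {c₂ η κ μ : ℝ}
    (i₀ : Fin N) (hσ : 0 < σ) (hc₂ : 0 ≤ c₂) (hμ : 0 ≤ μ) (hη₀ : 0 ≤ η) (hf₀ : 0 < f ⬝ᵥ f)
    (hf : (∑ a, |f a|) ^ 2 ≤ κ * (f ⬝ᵥ f)) (hκ : 0 ≤ κ) (hS : f ⬝ᵥ (S *ᵥ f) ≤ c₂ * (f ⬝ᵥ f))
    (hη : ∀ a b, |(sampleCov X - S) a b| ≤ η) (hΘ : CLIMEFeasible (sampleCov X) μ Θ)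
    (hηκ : κ * η ≤ c₂) (hμκ : κ * μ ≤ 1 / 2) :
    |contrastStat f σ (f ⬝ᵥ βs) X (X *ᵥ βs + ε) βhat Θ - contrastNoise i₀ f σ X ε Θ|
      ≤ √(8 * c₂ * κ) * (√N * μ * (∑ a, |(βhat - βs) a|) / σ) := by
  have h_var := dotProduct_self_le_mul_sandwich hf₀
    (dotProduct_sampleCov_mulVec_le_two_mul hS hη hη₀ hf hηκ)
    (hΘ.half_dotProduct_self_le hμ hf hμκ)
  have h_var_pos := pos_of_mul_pos_right (hf₀.trans_le h_var) (by positivity)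
  have h_sd := Real.sqrt_pos.2 h_var_pos
  rw [contrastStat_eq_contrastNoise_sub i₀ hσ.ne' h_var_pos, sub_sub_cancel_left, abs_neg,
    abs_div, abs_mul, abs_of_nonneg (Real.sqrt_nonneg _), abs_of_pos (mul_pos hσ h_sd),
    div_le_iff₀ (mul_pos hσ h_sd)]
  calc √N * |f ⬝ᵥ ((Θ * sampleCov X - 1) *ᵥ (βhat - βs))|
      ≤ √N * (√(8 * c₂ * κ) * μ * (∑ a, |(βhat - βs) a|)
          * √(f ⬝ᵥ ((Θ * sampleCov X * Θᵀ) *ᵥ f))) := by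
        gcongr
        exact hΘ.abs_bias_le hμ hκ hf hc₂ h_var _
    _ = _ := by field_simp

lemma contrastStat_eq_mul (hσ : σ ≠ 0) (y : Fin N → ℝ) :
    contrastStat f s c X y βhat Θ = contrastStat f σ c X y βhat Θ * (σ / s) := by
  rw [contrastStat, contrastStat, div_mul_div_comm, mul_comm _ σ, mul_assoc σ,
    mul_div_mul_left _ _ hσ, mul_comm s]

lemma abs_contrastStat_sub_contrastStat_le (hσ : 0 < σ) (hτ : |s - σ| ≤ τ * σ) (hτ' : τ ≤ 1 / 2)
    (y : Fin N → ℝ) :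
    |contrastStat f s c X y βhat Θ - contrastStat f σ c X y βhat Θ|
      ≤ |contrastStat f σ c X y βhat Θ| * (2 * τ) := by
  have hτ₀ : 0 ≤ τ := nonneg_of_mul_nonneg_left ((abs_nonneg _).trans hτ) hσ
  have h_half : σ / 2 ≤ s := by nlinarith [(abs_le.1 hτ).1]
  have hs : 0 < s := by linarith
  rw [contrastStat_eq_mul hσ.ne', ← mul_sub_one, abs_mul]
  refine mul_le_mul_of_nonneg_left ?_ (abs_nonneg _)
  rw [div_sub_one hs.ne', abs_div, abs_sub_comm, abs_of_pos hs, div_le_iff₀ hs]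
  nlinarith

end ContrastStat

section NoiseLevel

variable {N n : ℕ} {σ γ Q : ℝ}

lemma sigmaHat_eq_mul_sqrt (X : Matrix (Fin N) (Fin n) ℝ) (ε : Fin N → ℝ) (βs βhat : Fin n → ℝ) :
    sigmaHat X (X *ᵥ βs + ε) βhat
      = √(1 / N) * √((ε - X *ᵥ (βhat - βs)) ⬝ᵥ (ε - X *ᵥ (βhat - βs))) := by
  rw [sigmaHat, sum_sq_residual, Real.sqrt_mul (by positivity)]

lemma abs_sigmaHat_sub_sqrt_le (X : Matrix (Fin N) (Fin n) ℝ) (ε : Fin N → ℝ)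
    (βs βhat : Fin n → ℝ) :
    |sigmaHat X (X *ᵥ βs + ε) βhat - √(1 / N * (ε ⬝ᵥ ε))|
      ≤ √((βhat - βs) ⬝ᵥ (sampleCov X *ᵥ (βhat - βs))) := by
  rw [sigmaHat_eq_mul_sqrt, dotProduct_sampleCov_mulVec, Real.sqrt_mul (by positivity),
    Real.sqrt_mul (by positivity), ← mul_sub, abs_mul, abs_of_nonneg (Real.sqrt_nonneg _)]
  gcongr
  exact abs_sqrt_sub_sqrt_le ε _

lemma abs_sqrt_sub_le_div {v : ℝ} (hv₀ : 0 ≤ v) (hσ : 0 < σ) (hv : |v - σ ^ 2| ≤ γ) :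
    |√v - σ| ≤ γ / σ := by
  have h_factor : v - σ ^ 2 = (√v - σ) * (√v + σ) := by
    linear_combination -Real.sq_sqrt hv₀
  have h_sum : σ ≤ √v + σ := le_add_of_nonneg_left (Real.sqrt_nonneg v)
  rw [le_div_iff₀ hσ]
  calc |√v - σ| * σ ≤ |√v - σ| * (√v + σ) := by gcongr
    _ = |v - σ ^ 2| := by rw [h_factor, abs_mul, abs_of_pos (hσ.trans_le h_sum)]
    _ ≤ γ := hv

lemma abs_sigmaHat_sub_le {X : Matrix (Fin N) (Fin n) ℝ} {ε : Fin N → ℝ} {βs βhat : Fin n → ℝ}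
    (hσ : 0 < σ) (hγ : |1 / (N : ℝ) * (ε ⬝ᵥ ε) - σ ^ 2| ≤ γ)
    (hQ : (βhat - βs) ⬝ᵥ (sampleCov X *ᵥ (βhat - βs)) ≤ Q) :
    |sigmaHat X (X *ᵥ βs + ε) βhat - σ| ≤ √Q + γ / σ := by
  have h_mean : 0 ≤ 1 / (N : ℝ) * (ε ⬝ᵥ ε) :=
    mul_nonneg (by positivity) (dotProduct_self_nonneg ε)
  calc |sigmaHat X (X *ᵥ βs + ε) βhat - σ|
      ≤ |sigmaHat X (X *ᵥ βs + ε) βhat - √(1 / N * (ε ⬝ᵥ ε))| + |√(1 / N * (ε ⬝ᵥ ε)) - σ| :=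
        abs_sub_le _ _ _
    _ ≤ √Q + γ / σ := add_le_add
        ((abs_sigmaHat_sub_sqrt_le X ε βs βhat).trans (Real.sqrt_le_sqrt hQ))
        (abs_sqrt_sub_le_div h_mean hσ hγ)

end NoiseLevel

section DesignConcentration

variable {Ω : Type*} [MeasurableSpace Ω] {P : Measure Ω} {N n : ℕ} {σx : ℝ}

lemma hasSubgaussianMGF_of_le {Z : Ω → ℝ} {v w : NNReal} (hZ : HasSubgaussianMGF Z v P)
    (hvw : v ≤ w) : HasSubgaussianMGF Z w P where
  integrable_exp_mul := hZ.integrable_exp_mul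
  mgf_le t := (hZ.mgf_le t).trans (by gcongr)

lemma IsSubGaussianVector.hasSubgaussianMGF_dotProduct {V : Ω → Fin n → ℝ}
    (hV : IsSubGaussianVector σx V P) (i₀ : Fin n) {w : Fin n → ℝ} {l : ℝ}
    (hw : w ⬝ᵥ w ≤ l ^ 2) : HasSubgaussianMGF (fun ω => w ⬝ᵥ V ω) ((σx * l) ^ 2).toNNReal P := by
  have h_unit := (hV.projection _ (direction_dotProduct_self i₀ w)).mgf_bound
  rw [show (fun ω => w ⬝ᵥ V ω) = fun ω => √(w ⬝ᵥ w) * (direction i₀ w ⬝ᵥ V ω) from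
    funext fun ω => dotProduct_eq_sqrt_mul_direction_dotProduct i₀ w (V ω)]
  refine hasSubgaussianMGF_of_le (h_unit.const_mul √(w ⬝ᵥ w)) ?_
  change √(w ⬝ᵥ w) ^ 2 * ((σx ^ 2).toNNReal : ℝ) ≤ ((σx * l) ^ 2).toNNReal
  rw [Real.coe_toNNReal _ (sq_nonneg _), Real.coe_toNNReal _ (sq_nonneg _),
    Real.sq_sqrt (dotProduct_self_nonneg w), mul_pow, mul_comm]
  gcongr

lemma single_one_dotProduct_self (a : Fin n) :
    (Pi.single a 1 : Fin n → ℝ) ⬝ᵥ Pi.single a 1 = 1 := by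
  rw [single_dotProduct, Pi.single_eq_same, one_mul]

lemma IsSubGaussianVector.hasSubgaussianMGF_apply {V : Ω → Fin n → ℝ}
    (hV : IsSubGaussianVector σx V P) (a : Fin n) :
    HasSubgaussianMGF (fun ω => V ω a) (σx ^ 2).toNNReal P := by
  simpa only [single_one_dotProduct] using
    (hV.projection _ (single_one_dotProduct_self a)).mgf_bound

variable {S : Matrix (Fin n) (Fin n) ℝ} {X : Ω → Matrix (Fin N) (Fin n) ℝ}

namespace IsRowwiseSubGaussian

lemma isHermitian (hX : IsRowwiseSubGaussian σx S X P) (i₀ : Fin N) : S.IsHermitian := by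
  ext a b
  rw [conjTranspose_apply, star_trivial, ← hX.cov_row i₀, ← hX.cov_row i₀, covariance_comm]

lemma memLp_two (hX : IsRowwiseSubGaussian σx S X P) (i : Fin N) (a : Fin n) :
    MemLp (fun ω => X ω i a) 2 P :=
  ((hX.subGaussian_row i).hasSubgaussianMGF_apply a).memLp 2

variable [IsProbabilityMeasure P]

lemma integral_mul (hX : IsRowwiseSubGaussian σx S X P) (i : Fin N) (a b : Fin n) :
    ∫ ω, X ω i a * X ω i b ∂P = S a b := by
  rw [← hX.cov_row i, covariance_eq_sub (hX.memLp_two i a) (hX.memLp_two i b),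
    (hX.subGaussian_row i).mean_zero, zero_mul, sub_zero]
  rfl

lemma integral_dotProduct_mul (hX : IsRowwiseSubGaussian σx S X P) (i : Fin N) (w : Fin n → ℝ)
    (b : Fin n) : ∫ ω, (w ⬝ᵥ X ω i) * X ω i b ∂P = (w ᵥ* S) b := by
  simp only [dotProduct, vecMul, Finset.sum_mul, mul_assoc]
  rw [integral_finsetSum]
  · exact Finset.sum_congr rfl fun a _ => by rw [integral_const_mul, hX.integral_mul]
  · exact fun a _ => ((hX.memLp_two i a).integrable_mul (hX.memLp_two i b)).const_mul _

end IsRowwiseSubGaussian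

lemma vecMul_sampleCov_apply (X : Matrix (Fin N) (Fin n) ℝ) (w : Fin n → ℝ) (b : Fin n) :
    (w ᵥ* sampleCov X) b = 1 / (N : ℝ) * ∑ i, (w ⬝ᵥ X i) * X i b := by
  rw [sampleCov, vecMul_smul, Pi.smul_apply, smul_eq_mul, ← vecMul_vecMul, vecMul_transpose]
  simp only [vecMul, dotProduct, mulVec, mul_comm (w _)]

namespace IsRowwiseSubGaussian

variable [IsProbabilityMeasure P] {r : ℝ}

lemma measureReal_lt_abs_vecMul_sampleCov_sub_le (hX : IsRowwiseSubGaussian σx S X P) [NeZero N]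
    (hσx : 0 < σx) {w : Fin n → ℝ} {l : ℝ} (hl : 0 < l) (hw : w ⬝ᵥ w ≤ l ^ 2) (b : Fin n)
    (hr : 0 ≤ r) (hr1 : r ≤ 1) :
    P.real {ω | 64 * (σx * l) * σx * r < |(w ᵥ* sampleCov (X ω)) b - (w ᵥ* S) b|}
      ≤ 2 * Real.exp (-(4 * (N * r ^ 2))) := by
  have h_indep : iIndepFun (fun i ω => (w ⬝ᵥ X ω i) * X ω i b) P :=
    hX.indep_rows.comp (fun _ v => (w ⬝ᵥ v) * v b) fun _ => by unfold dotProduct; fun_prop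
  have h_bound := measureReal_lt_abs_average_mul_sub_le (mul_pos hσx hl) hσx h_indep
    (fun i => (hX.subGaussian_row i).hasSubgaussianMGF_dotProduct b hw)
    (fun i => (hX.subGaussian_row i).hasSubgaussianMGF_apply b)
    (fun i => hX.integral_dotProduct_mul i w b) hr hr1
  simpa only [vecMul_sampleCov_apply, Fintype.card_fin] using h_bound

lemma measureReal_lt_abs_sampleCov_sub_le (hX : IsRowwiseSubGaussian σx S X P) [NeZero N]
    (hσx : 0 < σx) (hr : 0 ≤ r) (hr1 : r ≤ 1) (a b : Fin n) :
    P.real {ω | 64 * σx ^ 2 * r < |(sampleCov (X ω) - S) a b|}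
      ≤ 2 * Real.exp (-(4 * (N * r ^ 2))) := by
  have h_bound := hX.measureReal_lt_abs_vecMul_sampleCov_sub_le hσx one_pos
    ((single_one_dotProduct_self a).trans_le (one_pow 2).ge) b hr hr1
  simp only [single_one_vecMul, mul_one] at h_bound
  rw [sq, ← mul_assoc]
  exact h_bound

lemma measureReal_lt_abs_inv_mul_sampleCov_sub_one_le (hX : IsRowwiseSubGaussian σx S X P)
    [NeZero N] (hσx : 0 < σx) {c : ℝ} (hc₀ : 0 < c) (hc : ∀ x ∈ spectrum ℝ S, c ≤ x)
    (hr : 0 ≤ r) (hr1 : r ≤ 1) (a b : Fin n) :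
    P.real {ω | 64 * σx ^ 2 / c * r < |(S⁻¹ * sampleCov (X ω) - 1) a b|}
      ≤ 2 * Real.exp (-(4 * (N * r ^ 2))) := by
  have h_bound := hX.measureReal_lt_abs_vecMul_sampleCov_sub_le hσx (one_div_pos.2 hc₀)
    (inv_row_dotProduct_self_le hc₀ (hX.isHermitian 0) hc a) b hr hr1
  have h_row : (S⁻¹ a ᵥ* S) b = (1 : Matrix (Fin n) (Fin n) ℝ) a b := by
    rw [← inv_mul_of_spectrum_pos fun x hx => hc₀.trans_le (hc x hx)]
    rfl
  rw [h_row, show 64 * (σx * (1 / c)) * σx * r = 64 * σx ^ 2 / c * r by ring] at h_bound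
  exact h_bound

end IsRowwiseSubGaussian

end DesignConcentration

section Measurability

variable {Ω : Type*} [MeasurableSpace Ω] {N n : ℕ}

lemma measurable_dotProduct_of_apply {ι : Type*} [Fintype ι] {u v : Ω → ι → ℝ}
    (hu : ∀ i, Measurable fun ω => u ω i) (hv : ∀ i, Measurable fun ω => v ω i) :
    Measurable fun ω => u ω ⬝ᵥ v ω :=
  Finset.measurable_sum _ fun i _ => (hu i).mul (hv i)

lemma measurable_mulVec_apply {ι κ : Type*} [Fintype κ] {A : Ω → Matrix ι κ ℝ} {v : Ω → κ → ℝ}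
    (hA : ∀ i j, Measurable fun ω => A ω i j) (hv : ∀ j, Measurable fun ω => v ω j) (i : ι) :
    Measurable fun ω => (A ω *ᵥ v ω) i :=
  measurable_dotProduct_of_apply (hA i) hv

lemma measurable_mul_apply {ι κ τ : Type*} [Fintype κ] {A : Ω → Matrix ι κ ℝ}
    {B : Ω → Matrix κ τ ℝ} (hA : ∀ i j, Measurable fun ω => A ω i j)
    (hB : ∀ i j, Measurable fun ω => B ω i j) (i : ι) (j : τ) :
    Measurable fun ω => (A ω * B ω) i j :=
  measurable_dotProduct_of_apply (hA i) fun k => hB k j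

variable {X : Ω → Matrix (Fin N) (Fin n) ℝ} {y : Ω → Fin N → ℝ} {βhat : Ω → Fin n → ℝ}
  {Θ : Ω → Matrix (Fin n) (Fin n) ℝ}

lemma measurable_oneStep_apply (hX : ∀ i a, Measurable fun ω => X ω i a)
    (hy : ∀ i, Measurable fun ω => y ω i) (hβ : ∀ a, Measurable fun ω => βhat ω a)
    (hΘ : ∀ a b, Measurable fun ω => Θ ω a b) (a : Fin n) :
    Measurable fun ω => oneStep (X ω) (y ω) (βhat ω) (Θ ω) a :=
  (hβ a).add ((measurable_mulVec_apply (measurable_mul_apply hΘ fun a i => hX i a)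
    (fun i => (hy i).sub (measurable_mulVec_apply hX hβ i)) a).const_mul _)

lemma measurable_sandwich_apply (hX : ∀ i a, Measurable fun ω => X ω i a)
    (hΘ : ∀ a b, Measurable fun ω => Θ ω a b) (a b : Fin n) :
    Measurable fun ω => (Θ ω * sampleCov (X ω) * (Θ ω)ᵀ) a b :=
  measurable_mul_apply (measurable_mul_apply hΘ fun a b =>
    (measurable_mul_apply (fun a i => hX i a) hX a b).const_mul _) (fun a b => hΘ b a) a b

lemma measurable_contrastStat (f : Fin n → ℝ) (c : ℝ) {s : Ω → ℝ} (hs : Measurable s)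
    (hX : ∀ i a, Measurable fun ω => X ω i a) (hy : ∀ i, Measurable fun ω => y ω i)
    (hβ : ∀ a, Measurable fun ω => βhat ω a) (hΘ : ∀ a b, Measurable fun ω => Θ ω a b) :
    Measurable fun ω => contrastStat f (s ω) c (X ω) (y ω) (βhat ω) (Θ ω) := by
  have h_num := measurable_dotProduct_of_apply (u := fun _ => f) (fun _ => measurable_const)
    (measurable_oneStep_apply hX hy hβ hΘ)
  have h_var := measurable_dotProduct_of_apply (u := fun _ => f) (fun _ => measurable_const)
    (measurable_mulVec_apply (v := fun _ => f) (measurable_sandwich_apply hX hΘ)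
      fun _ => measurable_const)
  exact ((h_num.sub_const c).const_mul _).div (hs.mul h_var.sqrt)

lemma measurable_sigmaHat (hX : ∀ i a, Measurable fun ω => X ω i a)
    (hy : ∀ i, Measurable fun ω => y ω i) (hβ : ∀ a, Measurable fun ω => βhat ω a) :
    Measurable fun ω => sigmaHat (X ω) (y ω) (βhat ω) :=
  ((Finset.measurable_sum _ fun i _ =>
    ((hy i).sub (measurable_mulVec_apply hX hβ i)).pow_const 2).const_mul _).sqrt

lemma IsCLIMEEstimator.measurable_mulVec_transpose_mulVec {μ : ℝ}
    {Θhat : Matrix (Fin N) (Fin n) ℝ → Matrix (Fin n) (Fin n) ℝ} (hΘhat : IsCLIMEEstimator μ Θhat)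
    (f : Fin n → ℝ) :
    Measurable fun x : Fin N → Fin n → ℝ => Matrix.of x *ᵥ ((Θhat (Matrix.of x))ᵀ *ᵥ f) :=
  measurable_pi_iff.2 <| measurable_mulVec_apply
    (fun i a => (measurable_pi_apply a).comp (measurable_pi_apply i))
    (measurable_mulVec_apply (v := fun _ => f) (fun a b => hΘhat.measurable_entry b a)
      fun _ => measurable_const)

end Measurability

lemma IsGaussianNoise.hasLaw_direction_dotProduct_div {Ω : Type*} [MeasurableSpace Ω]
    {P : Measure Ω} {N n : ℕ} {X : Ω → Matrix (Fin N) (Fin n) ℝ}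
    {ε : Ω → Fin N → ℝ} {σ : ℝ} (hε : IsGaussianNoise σ ε P) (hσ : σ ≠ 0)
    (hX : ∀ i, Measurable fun ω => X ω i) (h_indep : IndepFun (fun ω i => X ω i) ε P) (i₀ : Fin N)
    {q : Matrix (Fin N) (Fin n) ℝ → Fin N → ℝ}
    (hq : Measurable fun x : Fin N → Fin n → ℝ => q (Matrix.of x)) :
    HasLaw (fun ω => direction i₀ (q (X ω)) ⬝ᵥ ε ω / σ) (gaussianReal 0 1) P :=
  hε.hasLaw_dotProduct_div_of_indepFun (Y := fun ω i => X ω i)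
    (a := fun x => direction i₀ (q (Matrix.of x))) hσ (measurable_pi_iff.2 hX) h_indep
    ((measurable_direction i₀).comp hq) fun _ => direction_dotProduct_self i₀ _

section Realisation

variable {N n : ℕ}

lemma abs_mean_transpose_mulVec_apply_le {X : Matrix (Fin N) (Fin n) ℝ} {ε : Fin N → ℝ}
    {σ v x : ℝ} (i₀ : Fin N) (hσ : 0 < σ) {a : Fin n} (hv : sampleCov X a a ≤ v)
    (hx : |direction i₀ (Xᵀ a) ⬝ᵥ ε / σ| ≤ x) :
    |1 / (N : ℝ) * (Xᵀ *ᵥ ε) a| ≤ √v * x * σ / √N := by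
  have hN : (0 : ℝ) < N := by exact_mod_cast i₀.pos
  have h_col : Xᵀ a ⬝ᵥ Xᵀ a ≤ N * v := by
    rw [← inv_mul_le_iff₀ hN, ← one_div]
    exact hv
  have h_dir : |direction i₀ (Xᵀ a) ⬝ᵥ ε| ≤ x * σ := by
    rwa [abs_div, abs_of_pos hσ, div_le_iff₀ hσ] at hx
  have h_sqrt : √(N : ℝ) * √N = N := Real.mul_self_sqrt hN.le
  have h_split : (Xᵀ *ᵥ ε) a = √(Xᵀ a ⬝ᵥ Xᵀ a) * (direction i₀ (Xᵀ a) ⬝ᵥ ε) :=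
    dotProduct_eq_sqrt_mul_direction_dotProduct i₀ (Xᵀ a) ε
  rw [h_split, abs_mul, abs_mul, abs_of_pos (one_div_pos.2 hN), abs_of_nonneg (Real.sqrt_nonneg _)]
  calc 1 / (N : ℝ) * (√(Xᵀ a ⬝ᵥ Xᵀ a) * |direction i₀ (Xᵀ a) ⬝ᵥ ε|)
      ≤ 1 / N * (√(N * v) * (x * σ)) := by gcongr
    _ = √v * x * σ / √N := by
      rw [Real.sqrt_mul hN.le]
      nth_rw 1 [← h_sqrt]
      field_simp

lemma abs_sub_le_of_relative_error {T T' W a e ℓ τ : ℝ} (h_T : |T - W| ≤ a)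
    (h_T' : |T' - T| ≤ |T| * (2 * τ)) (h_W : |W| ≤ 2 * ℓ) (hτ₀ : 0 ≤ τ) (hτ : τ ≤ 1 / 2)
    (hℓτ : ℓ * τ ≤ e) : |T' - W| ≤ 2 * a + 4 * e := by
  have h_abs : |T| ≤ 2 * ℓ + a := by linarith [abs_sub_abs_le_abs_sub T W]
  have h_a : a * (2 * τ) ≤ a * 1 :=
    mul_le_mul_of_nonneg_left (by linarith) ((abs_nonneg _).trans h_T)
  have h_prod : |T| * (2 * τ) ≤ (2 * ℓ + a) * (2 * τ) := by gcongr
  linarith [abs_sub_le T' T W]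

end Realisation

lemma measureReal_exists_le {Ω ι : Type*} [MeasurableSpace Ω] {P : Measure Ω}
    [Fintype ι] {p : ι → Ω → Prop} {c : ℝ} (h : ∀ i, P.real {ω | p i ω} ≤ c) :
    P.real {ω | ∃ i, p i ω} ≤ Fintype.card ι * c := by
  rw [Set.ofPred_exists]
  calc P.real (⋃ i, {ω | p i ω}) ≤ ∑ i, P.real {ω | p i ω} := measureReal_iUnion_fintype_le _
    _ ≤ ∑ _i : ι, c := Finset.sum_le_sum fun i _ => h i
    _ = Fintype.card ι * c := by rw [Finset.sum_const, nsmul_eq_mul, Finset.card_univ]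

/-- The factor of `√(log n / N)` in the smallest admissible tuning parameters. Its first entry makes
the inverse covariance matrix feasible for the CLIME problem, its second one makes the `ℓ₁` penalty
dominate the correlations of the noise with the columns of the design. -/
noncomputable def tuningConst (σx c₁ c₂ : ℝ) : ℝ := max (64 * σx ^ 2 / c₁) (4 * √(2 * c₂))

lemma tuningConst_pos {σx c₁ : ℝ} (hσx : 0 < σx) (hc₁ : 0 < c₁) (c₂ : ℝ) :
    0 < tuningConst σx c₁ c₂ :=
  lt_max_of_lt_left (by positivity)

/-- One stage of the asymptotics: a linear model `X βs + ε` with `N` observations of `n` covariates,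
a sparse fused lasso estimator `βhat` with penalty matrix `D`, a CLIME estimator `Θhat`, and a
contrast `f` of interest. The graph enters only through a bound `b` on `‖D‖²`, balanced against the
sparsity levels by `penalty_balance`, and through a bound `κ` on `‖f‖₁² / ‖f‖₂²`. -/
structure FusedLassoModel (σx c₁ c₂ κ C₁ : ℝ) where
  N : ℕ
  n : ℕ
  s₁ : ℕ
  s₂ : ℕ
  [neZero_N : NeZero N]
  R : Type
  [fintype_R : Fintype R]
  D : Matrix R (Fin n) ℝ
  b : ℝ
  lamD : ℝ
  lam : ℝ
  μ : ℝ
  σ : ℝ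
  βs : Fin n → ℝ
  f : Fin n → ℝ
  S : Matrix (Fin n) (Fin n) ℝ
  Ω : Type*
  [measurableSpace : MeasurableSpace Ω]
  P : Measure Ω
  [isProbabilityMeasure : IsProbabilityMeasure P]
  X : Ω → Matrix (Fin N) (Fin n) ℝ
  ε : Ω → Fin N → ℝ
  βhat : Ω → Fin n → ℝ
  Θhat : Matrix (Fin N) (Fin n) ℝ → Matrix (Fin n) (Fin n) ℝ
  σx_pos : 0 < σx
  c₁_pos : 0 < c₁
  σ_pos : 0 < σ
  s₂_pos : 0 < s₂
  penalty_le : ∀ h, (D *ᵥ h) ⬝ᵥ (D *ᵥ h) ≤ b * (h ⬝ᵥ h)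
  lamD_nonneg : 0 ≤ lamD
  penalty_balance : lamD * √(b * s₁) ≤ lam * √s₂
  penalty_sparse : hammingNorm (D *ᵥ βs) ≤ s₁
  sparse : hammingNorm βs ≤ s₂
  contrast_pos : 0 < f ⬝ᵥ f
  contrast_le : (∑ a, |f a|) ^ 2 ≤ κ * (f ⬝ᵥ f)
  le_lam : tuningConst σx c₁ c₂ * (σ * √(Real.log n / N)) ≤ lam
  lam_le : lam ≤ C₁ * (σ * √(Real.log n / N))
  le_μ : tuningConst σx c₁ c₂ * √(Real.log n / N) ≤ μ
  μ_le : μ ≤ C₁ * √(Real.log n / N)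
  subGaussian : IsRowwiseSubGaussian σx S X P
  spectrum_subset : spectrum ℝ S ⊆ Set.Icc c₁ c₂
  gaussian : IsGaussianNoise σ ε P
  indep : IndepFun (fun ω i => X ω i) ε P
  measurable_βhat : Measurable βhat
  isFusedLasso : ∀ᵐ ω ∂P, IsFusedLasso D lamD lam (X ω) (X ω *ᵥ βs + ε ω) (βhat ω)
  isCLIME : IsCLIMEEstimator μ Θhat

namespace FusedLassoModel

attribute [instance] neZero_N fintype_R measurableSpace isProbabilityMeasure

variable {σx c₁ c₂ κ C₁ : ℝ}

section SingleStage

variable (m : FusedLassoModel σx c₁ c₂ κ C₁)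

/-- The rate `√(log n / N)` of entrywise concentration. -/
noncomputable def rate : ℝ := √(Real.log m.n / m.N)

/-- The order `s₂ log n / √N` of the bias of the debiased estimator relative to its standard
deviation. -/
noncomputable def biasRate : ℝ := m.s₂ * Real.log m.n / √m.N

/-- The response of the linear model. -/
def response (ω : m.Ω) : Fin m.N → ℝ := m.X ω *ᵥ m.βs + m.ε ω

/-- The residual estimate of the noise level. -/
noncomputable def noiseLevel (ω : m.Ω) : ℝ := sigmaHat (m.X ω) (m.response ω) (m.βhat ω)

/-- The debiased statistic of the contrast, centred at `c` and scaled by the noise level `s`. -/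
noncomputable def stat (s c : ℝ) (ω : m.Ω) : ℝ :=
  contrastStat m.f s c (m.X ω) (m.response ω) (m.βhat ω) (m.Θhat (m.X ω))

/-- The standardised noise that the debiased statistic approximates. -/
noncomputable def noise (ω : m.Ω) : ℝ :=
  contrastNoise 0 m.f m.σ (m.X ω) (m.ε ω) (m.Θhat (m.X ω))

lemma dotProduct_cov_mulVec_le (h : Fin m.n → ℝ) : h ⬝ᵥ (m.S *ᵥ h) ≤ c₂ * (h ⬝ᵥ h) :=
  dotProduct_mulVec_le_of_spectrum (m.subGaussian.isHermitian 0)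
    (fun _ hx => (m.spectrum_subset hx).2) h

lemma mul_dotProduct_self_le (h : Fin m.n → ℝ) : c₁ * (h ⬝ᵥ h) ≤ h ⬝ᵥ (m.S *ᵥ h) :=
  mul_dotProduct_self_le_of_spectrum (m.subGaussian.isHermitian 0)
    (fun _ hx => (m.spectrum_subset hx).1) h

include m in
lemma c₂_pos : 0 < c₂ :=
  m.c₁_pos.trans_le <| le_of_mul_le_mul_right
    ((m.mul_dotProduct_self_le m.f).trans (m.dotProduct_cov_mulVec_le m.f)) m.contrast_pos

include m in
lemma κ_nonneg : 0 ≤ κ :=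
  nonneg_of_mul_nonneg_left ((sq_nonneg _).trans m.contrast_le) m.contrast_pos

lemma b_nonneg : 0 ≤ m.b :=
  nonneg_of_mul_nonneg_left ((dotProduct_self_nonneg _).trans (m.penalty_le m.f)) m.contrast_pos

lemma natCast_N_pos : (0 : ℝ) < m.N := by exact_mod_cast NeZero.pos m.N

lemma one_le_s₂ : (1 : ℝ) ≤ m.s₂ := by exact_mod_cast m.s₂_pos

lemma rate_nonneg : 0 ≤ m.rate := Real.sqrt_nonneg _

lemma log_nonneg : 0 ≤ Real.log m.n := Real.log_natCast_nonneg _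

lemma rate_eq_div : m.rate = √(Real.log m.n) / √m.N := Real.sqrt_div m.log_nonneg _

lemma N_mul_rate_sq : m.N * m.rate ^ 2 = Real.log m.n := by
  rw [rate, Real.sq_sqrt (div_nonneg m.log_nonneg m.N.cast_nonneg),
    mul_div_cancel₀ _ m.natCast_N_pos.ne']

lemma sqrt_log_mul_rate : √(Real.log m.n) * m.rate = Real.log m.n / √m.N := by
  rw [rate_eq_div, ← mul_div_assoc, Real.mul_self_sqrt m.log_nonneg]

lemma sqrt_N_mul_rate : √m.N * m.rate = √(Real.log m.n) := by
  rw [rate_eq_div, mul_div_cancel₀ _ (Real.sqrt_pos.2 m.natCast_N_pos).ne']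

lemma rate_pos (hn : 1 < m.n) : 0 < m.rate :=
  Real.sqrt_pos.2 (div_pos (Real.log_pos (by exact_mod_cast hn)) m.natCast_N_pos)

lemma lam_pos (hn : 1 < m.n) : 0 < m.lam :=
  (mul_pos (tuningConst_pos m.σx_pos m.c₁_pos c₂) (mul_pos m.σ_pos (m.rate_pos hn))).trans_le
    m.le_lam

lemma μ_nonneg : 0 ≤ m.μ :=
  (mul_nonneg (tuningConst_pos m.σx_pos m.c₁_pos c₂).le m.rate_nonneg).trans m.le_μ

lemma C₁_nonneg (hn : 1 < m.n) : 0 ≤ C₁ :=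
  nonneg_of_mul_nonneg_left (m.μ_nonneg.trans m.μ_le) (m.rate_pos hn)

lemma le_half_lam : √(2 * c₂) * (2 * √(Real.log m.n)) * m.σ / √m.N ≤ m.lam / 2 := by
  have h := (mul_le_mul_of_nonneg_right (le_max_right (64 * σx ^ 2 / c₁) (4 * √(2 * c₂)))
    (mul_nonneg m.σ_pos.le m.rate_nonneg)).trans m.le_lam
  rw [rate_eq_div] at h
  linear_combination h / 2

lemma cov_error_le_μ : 64 * σx ^ 2 / c₁ * m.rate ≤ m.μ :=
  (mul_le_mul_of_nonneg_right (le_max_left _ _) m.rate_nonneg).trans m.le_μ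

lemma s₂_mul_rate_le (hn : 1 < m.n) : m.s₂ * m.rate ≤ 2 * m.biasRate := by
  have h_log : 1 / 4 ≤ Real.log m.n := by
    have : Real.log 2 ≤ Real.log m.n := Real.log_le_log two_pos (by exact_mod_cast hn)
    linarith [Real.log_two_gt_d9]
  have h_sqrt : √(Real.log m.n) ≤ 2 * Real.log m.n :=
    Real.sqrt_le_iff.2 ⟨by linarith, by nlinarith⟩
  rw [rate_eq_div, biasRate]
  calc m.s₂ * (√(Real.log m.n) / √m.N) ≤ m.s₂ * (2 * Real.log m.n / √m.N) := by gcongr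
    _ = 2 * (m.s₂ * Real.log m.n / √m.N) := by ring

/-- The rates of convergence at the stage `m` are small enough for the deterministic analysis. -/
structure HasSmallRate : Prop where
  one_lt_n : 1 < m.n
  rate_le_one : m.rate ≤ 1
  sparsity_le : 36 * m.s₂ * (64 * σx ^ 2 * m.rate) ≤ c₁ / 2
  cov_le : 64 * σx ^ 2 * m.rate ≤ c₂
  contrast_cov_le : κ * (64 * σx ^ 2 * m.rate) ≤ c₂
  contrast_μ_le : κ * (C₁ * m.rate) ≤ 1 / 2
  noiseLevel_le : (√(72 / c₁) * C₁ + 64) * (m.rate * √m.s₂) ≤ 1 / 2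

/-- The event on which the design and the noise concentrate and `βhat` is a fused lasso estimate. -/
structure IsGood (ω : m.Ω) : Prop where
  isFusedLasso : IsFusedLasso m.D m.lamD m.lam (m.X ω) (m.response ω) (m.βhat ω)
  cov : ∀ a b, |(sampleCov (m.X ω) - m.S) a b| ≤ 64 * σx ^ 2 * m.rate
  inv_mul_cov : ∀ a b, |(m.S⁻¹ * sampleCov (m.X ω) - 1) a b| ≤ 64 * σx ^ 2 / c₁ * m.rate
  column_noise : ∀ a, |direction 0 ((m.X ω)ᵀ a) ⬝ᵥ m.ε ω / m.σ| ≤ 2 * √(Real.log m.n)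
  mean_sq_noise : |1 / (m.N : ℝ) * (m.ε ω ⬝ᵥ m.ε ω) - m.σ ^ 2| ≤ 64 * m.σ * m.σ * m.rate
  contrast_noise : |m.noise ω| ≤ 2 * √(Real.log m.n)

section Deterministic

variable {m} {ω : m.Ω}

lemma IsGood.climeFeasible (h : m.IsGood ω) :
    CLIMEFeasible (sampleCov (m.X ω)) m.μ (m.Θhat (m.X ω)) :=
  (m.isCLIME.solves _ ⟨m.S⁻¹, fun a b => (h.inv_mul_cov a b).trans m.cov_error_le_μ⟩).1

lemma cov_error_nonneg (m : FusedLassoModel σx c₁ c₂ κ C₁) : 0 ≤ 64 * σx ^ 2 * m.rate :=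
  mul_nonneg (by positivity) m.rate_nonneg

lemma IsGood.sampleCov_apply_self_le (h : m.IsGood ω) (hm : m.HasSmallRate) (a : Fin m.n) :
    sampleCov (m.X ω) a a ≤ 2 * c₂ := by
  have h_diag : m.S a a ≤ c₂ := by
    simpa using m.dotProduct_cov_mulVec_le (Pi.single a 1)
  have h_dev := (abs_le.1 (h.cov a a)).2
  rw [Matrix.sub_apply] at h_dev
  linarith [hm.cov_le]

lemma IsGood.abs_mean_transpose_mulVec_noise_le (h : m.IsGood ω) (hm : m.HasSmallRate)
    (a : Fin m.n) : |1 / (m.N : ℝ) * ((m.X ω)ᵀ *ᵥ m.ε ω) a| ≤ m.lam / 2 :=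
  (abs_mean_transpose_mulVec_apply_le 0 m.σ_pos (h.sampleCov_apply_self_le hm a)
    (h.column_noise a)).trans m.le_half_lam

lemma IsGood.error_bounds (h : m.IsGood ω) (hm : m.HasSmallRate) :
    ∑ a, |(m.βhat ω - m.βs) a| ≤ 72 * m.lam * m.s₂ / c₁ ∧
      (m.βhat ω - m.βs) ⬝ᵥ (sampleCov (m.X ω) *ᵥ (m.βhat ω - m.βs))
        ≤ 72 * m.lam ^ 2 * m.s₂ / c₁ := by
  have h_lam := m.lam_pos hm.one_lt_n
  exact error_bounds_of_basic_inequality h_lam m.c₁_pos (m.mul_dotProduct_self_le _) h.cov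
    m.cov_error_nonneg hm.sparsity_le
    (h.isFusedLasso.basic_inequality m.penalty_le m.b_nonneg m.lamD_nonneg h_lam.le
      m.penalty_balance m.penalty_sparse m.sparse (h.abs_mean_transpose_mulVec_noise_le hm))

lemma IsGood.abs_stat_sub_noise_le (h : m.IsGood ω) (hm : m.HasSmallRate) :
    |m.stat m.σ (m.f ⬝ᵥ m.βs) ω - m.noise ω|
      ≤ √(8 * c₂ * κ) * (72 * C₁ ^ 2 / c₁) * m.biasRate := by
  have h_c₁ := m.c₁_pos
  have h_σ := m.σ_pos
  have h_rate := m.rate_nonneg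
  have h_C₁ := m.C₁_nonneg hm.one_lt_n
  have h_l1 : ∑ a, |(m.βhat ω - m.βs) a| ≤ 72 * (C₁ * (m.σ * m.rate)) * m.s₂ / c₁ :=
    (h.error_bounds hm).1.trans (by gcongr; exact m.lam_le)
  have h_close := abs_contrastStat_sub_contrastNoise_le (βs := m.βs) (ε := m.ε ω)
    (βhat := m.βhat ω) 0 h_σ m.c₂_pos.le m.μ_nonneg m.cov_error_nonneg m.contrast_pos
    m.contrast_le m.κ_nonneg (m.dotProduct_cov_mulVec_le _) h.cov h.climeFeasible
    hm.contrast_cov_le ((mul_le_mul_of_nonneg_left m.μ_le m.κ_nonneg).trans hm.contrast_μ_le)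
  calc |m.stat m.σ (m.f ⬝ᵥ m.βs) ω - m.noise ω|
      ≤ √(8 * c₂ * κ) * (√m.N * m.μ * (∑ a, |(m.βhat ω - m.βs) a|) / m.σ) := h_close
    _ ≤ √(8 * c₂ * κ)
          * (√m.N * (C₁ * m.rate) * (72 * (C₁ * (m.σ * m.rate)) * m.s₂ / c₁) / m.σ) := by
        gcongr
        exact m.μ_le
    _ = √(8 * c₂ * κ) * (72 * C₁ ^ 2 / c₁) * (m.s₂ * (√m.N * m.rate * m.rate)) := by
        field_simp
    _ = √(8 * c₂ * κ) * (72 * C₁ ^ 2 / c₁) * m.biasRate := by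
        rw [sqrt_N_mul_rate, sqrt_log_mul_rate, biasRate, mul_div_assoc (m.s₂ : ℝ)]

lemma IsGood.abs_noiseLevel_sub_le (h : m.IsGood ω) (hm : m.HasSmallRate) :
    |m.noiseLevel ω - m.σ| ≤ (√(72 / c₁) * C₁ + 64) * (m.rate * √m.s₂) * m.σ := by
  have h_c₁ := m.c₁_pos
  have h_σ := m.σ_pos
  have h_rate := m.rate_nonneg
  have h_sqrt : √(72 * m.lam ^ 2 * m.s₂ / c₁) = √(72 / c₁) * m.lam * √m.s₂ := by
    rw [show 72 * m.lam ^ 2 * m.s₂ / c₁ = 72 / c₁ * m.lam ^ 2 * m.s₂ by ring,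
      Real.sqrt_mul (by positivity), Real.sqrt_mul (by positivity),
      Real.sqrt_sq (m.lam_pos hm.one_lt_n).le]
  calc |m.noiseLevel ω - m.σ|
      ≤ √(72 * m.lam ^ 2 * m.s₂ / c₁) + 64 * m.σ * m.σ * m.rate / m.σ :=
        abs_sigmaHat_sub_le h_σ h.mean_sq_noise (h.error_bounds hm).2
    _ = √(72 / c₁) * m.lam * √m.s₂ + 64 * (m.rate * 1) * m.σ := by
        rw [h_sqrt]
        field_simp
    _ ≤ √(72 / c₁) * (C₁ * (m.σ * m.rate)) * √m.s₂ + 64 * (m.rate * √m.s₂) * m.σ := by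
        gcongr
        · exact m.lam_le
        · exact Real.one_le_sqrt.2 m.one_le_s₂
    _ = (√(72 / c₁) * C₁ + 64) * (m.rate * √m.s₂) * m.σ := by ring

lemma sqrt_log_mul_rate_mul_sqrt_le (m : FusedLassoModel σx c₁ c₂ κ C₁) :
    √(Real.log m.n) * (m.rate * √m.s₂) ≤ m.biasRate := by
  have h_sqrt : √(m.s₂ : ℝ) ≤ m.s₂ := Real.sqrt_le_self_iff.2 (Or.inr m.one_le_s₂)
  rw [← mul_assoc, sqrt_log_mul_rate, biasRate, mul_comm, ← mul_div_assoc]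
  gcongr

lemma IsGood.abs_stat_noiseLevel_sub_noise_le (h : m.IsGood ω) (hm : m.HasSmallRate) :
    |m.stat (m.noiseLevel ω) (m.f ⬝ᵥ m.βs) ω - m.noise ω|
      ≤ 2 * (√(8 * c₂ * κ) * (72 * C₁ ^ 2 / c₁) * m.biasRate)
        + 4 * ((√(72 / c₁) * C₁ + 64) * m.biasRate) := by
  have h_C₁ := m.C₁_nonneg hm.one_lt_n
  have h_rate := m.rate_nonneg
  refine abs_sub_le_of_relative_error (h.abs_stat_sub_noise_le hm)
    (abs_contrastStat_sub_contrastStat_le m.σ_pos (h.abs_noiseLevel_sub_le hm) hm.noiseLevel_le _)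
    h.contrast_noise (by positivity) hm.noiseLevel_le ?_
  rw [mul_left_comm]
  gcongr
  exact m.sqrt_log_mul_rate_mul_sqrt_le

end Deterministic

section Probability

lemma exp_neg_four_mul_N_mul_rate_sq (hn : 0 < m.n) :
    Real.exp (-(4 * (m.N * m.rate ^ 2))) = 1 / (m.n : ℝ) ^ 4 := by
  rw [N_mul_rate_sq, Real.exp_neg, mul_comm, Real.exp_mul, Real.exp_log (by exact_mod_cast hn),
    one_div]
  norm_cast

lemma exp_neg_two_mul_sqrt_log_sq (hn : 0 < m.n) :
    Real.exp (-((2 * √(Real.log m.n)) ^ 2 / 2)) = 1 / (m.n : ℝ) ^ 2 := by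
  rw [mul_pow, Real.sq_sqrt m.log_nonneg,
    show (2 : ℝ) ^ 2 * Real.log m.n / 2 = Real.log m.n * 2 by ring, Real.exp_neg, Real.exp_mul,
    Real.exp_log (by exact_mod_cast hn), one_div]
  norm_cast

lemma hasLaw_direction_dotProduct_noise_div {q : Matrix (Fin m.N) (Fin m.n) ℝ → Fin m.N → ℝ}
    (hq : Measurable fun x : Fin m.N → Fin m.n → ℝ => q (Matrix.of x)) :
    HasLaw (fun ω => direction 0 (q (m.X ω)) ⬝ᵥ m.ε ω / m.σ) (gaussianReal 0 1) m.P :=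
  m.gaussian.hasLaw_direction_dotProduct_div m.σ_pos.ne' m.subGaussian.measurable_row m.indep 0 hq

lemma hasLaw_noise : HasLaw m.noise (gaussianReal 0 1) m.P :=
  m.hasLaw_direction_dotProduct_noise_div (q := fun x => x *ᵥ ((m.Θhat x)ᵀ *ᵥ m.f))
    (m.isCLIME.measurable_mulVec_transpose_mulVec m.f)

variable {m}

lemma HasSmallRate.n_pos (hm : m.HasSmallRate) : 0 < m.n := zero_lt_one.trans hm.one_lt_n

lemma HasSmallRate.measureReal_cov_le (hm : m.HasSmallRate) :
    m.P.real {ω | ∃ a b, 64 * σx ^ 2 * m.rate < |(sampleCov (m.X ω) - m.S) a b|}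
      ≤ m.n * (m.n * (2 * (1 / (m.n : ℝ) ^ 4))) := by
  have h := measureReal_exists_le fun a => measureReal_exists_le fun b =>
    m.subGaussian.measureReal_lt_abs_sampleCov_sub_le m.σx_pos m.rate_nonneg hm.rate_le_one a b
  rwa [m.exp_neg_four_mul_N_mul_rate_sq hm.n_pos, Fintype.card_fin] at h

lemma HasSmallRate.measureReal_inv_mul_cov_le (hm : m.HasSmallRate) :
    m.P.real {ω | ∃ a b, 64 * σx ^ 2 / c₁ * m.rate < |(m.S⁻¹ * sampleCov (m.X ω) - 1) a b|}
      ≤ m.n * (m.n * (2 * (1 / (m.n : ℝ) ^ 4))) := by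
  have h := measureReal_exists_le fun a => measureReal_exists_le fun b =>
    m.subGaussian.measureReal_lt_abs_inv_mul_sampleCov_sub_one_le m.σx_pos m.c₁_pos
      (fun _ hx => (m.spectrum_subset hx).1) m.rate_nonneg hm.rate_le_one a b
  rwa [m.exp_neg_four_mul_N_mul_rate_sq hm.n_pos, Fintype.card_fin] at h

lemma HasSmallRate.measureReal_column_noise_le (hm : m.HasSmallRate) :
    m.P.real {ω | ∃ a, 2 * √(Real.log m.n) < |direction 0 ((m.X ω)ᵀ a) ⬝ᵥ m.ε ω / m.σ|}
      ≤ m.n * (2 * (1 / (m.n : ℝ) ^ 2)) := by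
  have h_meas (a : Fin m.n) :
      Measurable fun x : Fin m.N → Fin m.n → ℝ => (Matrix.of x)ᵀ a :=
    measurable_pi_iff.2 fun i => (measurable_pi_apply a).comp (measurable_pi_apply i)
  have h := measureReal_exists_le fun a => measureReal_lt_abs_le_of_hasLaw_gaussianReal
    (m.hasLaw_direction_dotProduct_noise_div (q := fun x => xᵀ a) (h_meas a))
    (by positivity : 0 ≤ 2 * √(Real.log m.n))
  rwa [m.exp_neg_two_mul_sqrt_log_sq hm.n_pos, Fintype.card_fin] at h

lemma HasSmallRate.measureReal_mean_sq_noise_le (hm : m.HasSmallRate) :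
    m.P.real {ω | 64 * m.σ * m.σ * m.rate < |1 / (m.N : ℝ) * (m.ε ω ⬝ᵥ m.ε ω) - m.σ ^ 2|}
      ≤ 2 * (1 / (m.n : ℝ) ^ 4) := by
  have h := measureReal_lt_abs_average_mul_sub_le m.σ_pos m.σ_pos
    (m.gaussian.indep.comp (fun _ z => z * z) fun _ => by fun_prop) m.gaussian.hasSubgaussianMGF
    m.gaussian.hasSubgaussianMGF m.gaussian.integral_mul_self m.rate_nonneg hm.rate_le_one
  rwa [Fintype.card_fin, m.exp_neg_four_mul_N_mul_rate_sq hm.n_pos] at h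

lemma HasSmallRate.measureReal_contrast_noise_le (hm : m.HasSmallRate) :
    m.P.real {ω | 2 * √(Real.log m.n) < |m.noise ω|} ≤ 2 * (1 / (m.n : ℝ) ^ 2) := by
  have h := measureReal_lt_abs_le_of_hasLaw_gaussianReal m.hasLaw_noise
    (by positivity : 0 ≤ 2 * √(Real.log m.n))
  rwa [m.exp_neg_two_mul_sqrt_log_sq hm.n_pos] at h

lemma sum_tail_bounds_le {x : ℝ} (hx : 1 ≤ x) :
    x * (x * (2 * (1 / x ^ 4))) + x * (x * (2 * (1 / x ^ 4))) + x * (2 * (1 / x ^ 2))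
      + 2 * (1 / x ^ 4) + 2 * (1 / x ^ 2) ≤ 10 / x := by
  have hx₀ : 0 < x := by linarith
  have h_cov : x * (x * (2 * (1 / x ^ 4))) = 2 * (1 / x ^ 2) := by field_simp
  have h_col : x * (2 * (1 / x ^ 2)) = 2 * (1 / x) := by field_simp
  have h_two : 1 / x ^ 2 ≤ 1 / x := one_div_le_one_div_of_le hx₀ (le_self_pow₀ hx two_ne_zero)
  have h_four : 1 / x ^ 4 ≤ 1 / x := one_div_le_one_div_of_le hx₀ (le_self_pow₀ hx four_ne_zero)
  rw [h_cov, h_col, div_eq_mul_one_div 10 x]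
  linarith

lemma HasSmallRate.measureReal_not_isGood_le (hm : m.HasSmallRate) :
    m.P.real {ω | ¬ m.IsGood ω} ≤ 10 / m.n := by
  have h_union := (measureReal_union_le _ _).trans <| add_le_add
    ((measureReal_union_le _ _).trans <| add_le_add
      ((measureReal_union_le _ _).trans <| add_le_add
        ((measureReal_union_le _ _).trans <| add_le_add
          hm.measureReal_cov_le hm.measureReal_inv_mul_cov_le)
        hm.measureReal_column_noise_le)
      hm.measureReal_mean_sq_noise_le)
    hm.measureReal_contrast_noise_le
  refine (ENNReal.toReal_mono (measure_ne_top _ _) (measure_mono_ae ?_)).trans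
    (h_union.trans (sum_tail_bounds_le (by exact_mod_cast hm.n_pos)))
  filter_upwards [m.isFusedLasso] with ω h_lasso h_bad
  change ω ∈ (_ : Set m.Ω)
  by_contra h_out
  simp only [Set.mem_union, Set.mem_ofPred_eq, not_or, not_exists, not_lt] at h_out
  obtain ⟨⟨⟨⟨h_cov, h_inv⟩, h_col⟩, h_sq⟩, h_noise⟩ := h_out
  exact h_bad ⟨h_lasso, h_cov, h_inv, h_col, h_sq, h_noise⟩

end Probability

section Measurability

lemma measurable_X_apply (i : Fin m.N) (a : Fin m.n) : Measurable fun ω => m.X ω i a :=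
  (measurable_pi_apply a).comp (m.subGaussian.measurable_row i)

lemma measurable_response_apply (i : Fin m.N) : Measurable fun ω => m.response ω i :=
  (measurable_mulVec_apply (v := fun _ => m.βs) m.measurable_X_apply
    (fun _ => measurable_const) i).add ((measurable_pi_apply i).comp m.gaussian.measurable_noise)

lemma measurable_βhat_apply (a : Fin m.n) : Measurable fun ω => m.βhat ω a :=
  (measurable_pi_apply a).comp m.measurable_βhat

lemma measurable_noiseLevel : Measurable m.noiseLevel :=
  measurable_sigmaHat m.measurable_X_apply m.measurable_response_apply m.measurable_βhat_apply

lemma measurable_stat (c : ℝ) {s : m.Ω → ℝ} (hs : Measurable s) :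
    Measurable fun ω => m.stat (s ω) c ω :=
  measurable_contrastStat m.f c hs m.measurable_X_apply m.measurable_response_apply
    m.measurable_βhat_apply fun a b =>
      (m.isCLIME.measurable_entry a b).comp (measurable_pi_iff.2 m.subGaussian.measurable_row)

end Measurability

end SingleStage

variable {m : ℕ → FusedLassoModel σx c₁ c₂ κ C₁}

lemma tendsto_s₂_mul_rate (hn : Tendsto (fun t => (m t).n) atTop atTop)
    (h_bias : Tendsto (fun t => (m t).biasRate) atTop (𝓝 0)) :
    Tendsto (fun t => (m t).s₂ * (m t).rate) atTop (𝓝 0) :=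
  squeeze_zero' (.of_forall fun t => mul_nonneg (m t).s₂.cast_nonneg (m t).rate_nonneg)
    ((hn.eventually_gt_atTop 1).mono fun t ht => (m t).s₂_mul_rate_le ht)
    (by simpa using h_bias.const_mul 2)

lemma tendsto_rate_mul_sqrt (h : Tendsto (fun t => (m t).s₂ * (m t).rate) atTop (𝓝 0)) :
    Tendsto (fun t => (m t).rate * √(m t).s₂) atTop (𝓝 0) := by
  refine squeeze_zero (fun t => mul_nonneg (m t).rate_nonneg (Real.sqrt_nonneg _)) (fun t => ?_) h
  rw [mul_comm]
  exact mul_le_mul_of_nonneg_right (Real.sqrt_le_self_iff.2 (Or.inr (m t).one_le_s₂))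
    (m t).rate_nonneg

lemma tendsto_rate (h : Tendsto (fun t => (m t).s₂ * (m t).rate) atTop (𝓝 0)) :
    Tendsto (fun t => (m t).rate) atTop (𝓝 0) :=
  squeeze_zero (fun t => (m t).rate_nonneg)
    (fun t => le_mul_of_one_le_left (m t).rate_nonneg (m t).one_le_s₂) h

lemma eventually_hasSmallRate (hn : Tendsto (fun t => (m t).n) atTop atTop)
    (h_bias : Tendsto (fun t => (m t).biasRate) atTop (𝓝 0)) :
    ∀ᶠ t in atTop, (m t).HasSmallRate := by
  have h_small {u : ℕ → ℝ} (a : ℝ) {b : ℝ} (hb : 0 < b) (hu : Tendsto u atTop (𝓝 0)) :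
      ∀ᶠ t in atTop, a * u t ≤ b :=
    (by simpa using hu.const_mul a : Tendsto (fun t => a * u t) atTop (𝓝 0)).eventually_le_const hb
  have h_sparse := tendsto_s₂_mul_rate hn h_bias
  have h_rate := tendsto_rate h_sparse
  filter_upwards [hn.eventually_gt_atTop 1, h_small 1 one_pos h_rate,
    h_small (36 * (64 * σx ^ 2)) (half_pos (m 0).c₁_pos) h_sparse,
    h_small (64 * σx ^ 2) (m 0).c₂_pos h_rate,
    h_small (κ * (64 * σx ^ 2)) (m 0).c₂_pos h_rate,
    h_small (κ * C₁) one_half_pos h_rate,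
    h_small (√(72 / c₁) * C₁ + 64) one_half_pos (tendsto_rate_mul_sqrt h_sparse)]
    with t h_n h_one h_s₂ h_cov h_contrast h_μ h_level
  exact ⟨h_n, by linarith, by linarith, h_cov, by linarith, by linarith, h_level⟩

lemma tendstoInDistribution_of_isGood {T : ∀ t, (m t).Ω → ℝ} {B : ℝ}
    (hn : Tendsto (fun t => (m t).n) atTop atTop)
    (h_bias : Tendsto (fun t => (m t).biasRate) atTop (𝓝 0)) (hT : ∀ t, Measurable (T t))
    (h_close : ∀ t ω, (m t).IsGood ω → (m t).HasSmallRate →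
      |T t ω - (m t).noise ω| ≤ B * (m t).biasRate) :
    TendstoInDistribution T atTop (id : ℝ → ℝ) (fun t => (m t).P) (gaussianReal 0 1) := by
  refine tendstoInDistribution_of_hasLaw_of_close (η := fun t => B * (m t).biasRate)
    (fun t => (hT t).aemeasurable) (fun t => (m t).hasLaw_noise)
    (by simpa using h_bias.const_mul B) ?_
  refine squeeze_zero' (.of_forall fun t => measureReal_nonneg)
    ((eventually_hasSmallRate hn h_bias).mono fun t hm => ?_)
    ((tendsto_natCast_atTop_atTop.comp hn).const_div_atTop 10)
  exact (measureReal_mono fun ω hω h_good => (h_close t ω h_good hm).not_gt hω).trans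
    hm.measureReal_not_isGood_le

end FusedLassoModel

section Graph

variable {n : ℕ} {G : SimpleGraph (Fin n)}

lemma mul_sqrt_mul_sqrt_le_of_le_div {lam ν b : ℝ} {s₁ s₂ : ℕ} (hlam : 0 ≤ lam) (hb : 0 < b)
    (hs₁ : 0 < s₁) (hs : ν ≤ (s₂ : ℝ) / s₁) : lam * √(ν / b) * √(b * s₁) ≤ lam * √s₂ := by
  have h_s₁ : (0 : ℝ) < s₁ := by exact_mod_cast hs₁
  rw [mul_assoc, ← Real.sqrt_mul' _ (by positivity), ← mul_assoc, div_mul_cancel₀ _ hb.ne']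
  gcongr
  exact (le_div_iff₀ h_s₁).1 hs

lemma tendsto_mul_log_div_sqrt {s n N d : ℕ → ℕ} (hd : ∀ t, 0 < d t)
    (h : Tendsto (fun t => (s t : ℝ) * Real.log (n t) * √((d t : ℝ) / N t)) atTop (𝓝 0)) :
    Tendsto (fun t => (s t : ℝ) * Real.log (n t) / √(N t)) atTop (𝓝 0) := by
  refine squeeze_zero (fun t => ?_) (fun t => ?_) h
  · have := Real.log_natCast_nonneg (n t)
    positivity
  · have h_deg : (1 : ℝ) ≤ d t := by exact_mod_cast hd t
    rw [div_eq_mul_inv, ← Real.sqrt_inv, inv_eq_one_div]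
    gcongr

/-- The stage of the asymptotics given by a graph-piecewise-polynomial lasso estimate for the
difference operator of order `k + 1` of `G`, with the edge contrast `βs e.1.2 - βs e.1.1`. -/
noncomputable def FusedLassoModel.ofGraph {σx c₁ c₂ C₁ ν σ lam μ : ℝ} {k N s₁ s₂ : ℕ}
    [DecidableRel G.Adj] {βs : Fin n → ℝ} {S : Matrix (Fin n) (Fin n) ℝ} {Ω : Type*}
    [MeasurableSpace Ω] {P : Measure Ω} [IsProbabilityMeasure P]
    {X : Ω → Matrix (Fin N) (Fin n) ℝ} {ε : Ω → Fin N → ℝ} {βhat : Ω → Fin n → ℝ}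
    {Θhat : Matrix (Fin N) (Fin n) ℝ → Matrix (Fin n) (Fin n) ℝ} (e : Edge G)
    (hσx : 0 < σx) (hc₁ : 0 < c₁) (hN : 0 < N) (hd : 0 < G.maxDegree) (hs₁ : 0 < s₁)
    (hs₂ : 0 < s₂) (hs : ν ≤ (s₂ : ℝ) / s₁) (hβs : βs ∈ paramSpace G k s₁ s₂) (hσ : 0 < σ)
    (hX : IsRowwiseSubGaussian σx S X P) (hS : spectrum ℝ S ⊆ Set.Icc c₁ c₂)
    (hε : IsGaussianNoise σ ε P) (h_indep : IndepFun (fun ω i => X ω i) ε P)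
    (hlam : tuningConst σx c₁ c₂ * (σ * √(Real.log n / N)) ≤ lam ∧
      lam ≤ C₁ * (σ * √(Real.log n / N)))
    (hμ : tuningConst σx c₁ c₂ * √(Real.log n / N) ≤ μ ∧ μ ≤ C₁ * √(Real.log n / N))
    (h_meas : Measurable βhat)
    (hβhat : ∀ᵐ ω ∂P, IsGraphLasso G k (lam * √(ν / (2 * (G.maxDegree : ℝ)) ^ (k + 1))) lam (X ω)
      (X ω *ᵥ βs + ε ω) (βhat ω))
    (hΘhat : IsCLIMEEstimator μ Θhat) : FusedLassoModel σx c₁ c₂ 2 C₁ :=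
  have h_lam : 0 ≤ lam := le_trans
    (mul_nonneg (tuningConst_pos hσx hc₁ c₂).le (mul_nonneg hσ.le (Real.sqrt_nonneg _))) hlam.1
  { N, n, s₁, s₂, σ, lam, μ, βs, S, Ω, P, X, ε, βhat, Θhat
    neZero_N := ⟨hN.ne'⟩
    R := DiffRow G k
    D := graphDiff G k
    b := (2 * G.maxDegree) ^ (k + 1)
    lamD := lam * √(ν / (2 * (G.maxDegree : ℝ)) ^ (k + 1))
    f := incidence G e
    σx_pos := hσx
    c₁_pos := hc₁
    σ_pos := hσ
    s₂_pos := hs₂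
    penalty_le := graphDiff_mulVec_dotProduct_self_le G k
    lamD_nonneg := mul_nonneg h_lam (Real.sqrt_nonneg _)
    penalty_balance := mul_sqrt_mul_sqrt_le_of_le_div h_lam (by positivity) hs₁ hs
    penalty_sparse := hβs.1
    sparse := hβs.2
    contrast_pos := by simp only [incidence_dotProduct_self, two_pos]
    contrast_le := by simp only [sum_abs_incidence, incidence_dotProduct_self, sq, le_refl]
    le_lam := hlam.1
    lam_le := hlam.2
    le_μ := hμ.1
    μ_le := hμ.2
    subGaussian := hX
    spectrum_subset := hS
    gaussian := hε
    indep := h_indep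
    measurable_βhat := h_meas
    isFusedLasso := hβhat
    isCLIME := hΘhat }

end Graph

end GraphLasso

theorem corollary4_general {σx c₁ c₂ κ C₁ : ℝ}
    (m : ℕ → GraphLasso.FusedLassoModel σx c₁ c₂ κ C₁)
    (hn : Tendsto (fun t => (m t).n) atTop atTop)
    (h_bias : Tendsto (fun t => (m t).biasRate) atTop (𝓝 0)) :
    TendstoInDistribution (fun t => (m t).stat (m t).σ ((m t).f ⬝ᵥ (m t).βs)) atTop (id : ℝ → ℝ)
      (fun t => (m t).P) (gaussianReal 0 1) ∧
    TendstoInDistribution (fun t ω => (m t).stat ((m t).noiseLevel ω) ((m t).f ⬝ᵥ (m t).βs) ω)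
      atTop (id : ℝ → ℝ) (fun t => (m t).P) (gaussianReal 0 1) ∧
    ∀ α z : ℝ, α < 1 → cdf (gaussianReal 0 1) z = 1 - α / 2 → (∀ t, (m t).f ⬝ᵥ (m t).βs = 0) →
      Tendsto (fun t => (m t).P.real {ω | z < |(m t).stat (m t).σ 0 ω|}) atTop (𝓝 α) ∧
      Tendsto (fun t => (m t).P.real {ω | z < |(m t).stat ((m t).noiseLevel ω) 0 ω|})
        atTop (𝓝 α) := by
  have h_known := GraphLasso.FusedLassoModel.tendstoInDistribution_of_isGood hn h_bias
    (fun t => (m t).measurable_stat ((m t).f ⬝ᵥ (m t).βs) measurable_const)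
    fun t ω h_good hm => h_good.abs_stat_sub_noise_le hm
  have h_estimated := GraphLasso.FusedLassoModel.tendstoInDistribution_of_isGood
    (B := 2 * (√(8 * c₂ * κ) * (72 * C₁ ^ 2 / c₁)) + 4 * (√(72 / c₁) * C₁ + 64)) hn h_bias
    (fun t => (m t).measurable_stat ((m t).f ⬝ᵥ (m t).βs) (m t).measurable_noiseLevel)
    fun t ω h_good hm => (h_good.abs_stat_noiseLevel_sub_noise_le hm).trans_eq (by ring)
  refine ⟨h_known, h_estimated, fun α z hα hz h_null => ?_⟩
  simp only [h_null] at h_known h_estimated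
  exact ⟨GraphLasso.tendsto_measureReal_lt_abs h_known hα hz,
    GraphLasso.tendsto_measureReal_lt_abs h_estimated hα hz⟩

theorem corollary4 (σx c₁ c₂ : ℝ) (hσx : 0 < σx) (hc₁ : 0 < c₁) (hc₂ : 0 < c₂) :
    ∃ C₀ : ℝ, 0 < C₀ ∧ ∀ (C₁ : ℝ) (k : ℕ) (ν : ℝ), 0 ≤ ν → ν < 1 →
    -- sample sizes, dimensions, graphs, sparsity levels
    ∀ (N n s₁ s₂ : ℕ → ℕ) (G : ∀ t, SimpleGraph (Fin (n t))) [∀ t, DecidableRel (G t).Adj]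
      -- true parameters, covariance matrices, bounds, noise levels, tuning parameters
      (βs : ∀ t, Fin (n t) → ℝ) (Sx : ∀ t, Matrix (Fin (n t)) (Fin (n t)) ℝ)
      (M σε lam μ : ℕ → ℝ)
      -- probability spaces, designs, noise, responses, estimators, and one edge at each stage
      (Ω : ℕ → Type*) [∀ t, MeasurableSpace (Ω t)] (P : ∀ t, Measure (Ω t))
      [∀ t, IsProbabilityMeasure (P t)]
      (X : ∀ t, Ω t → Matrix (Fin (N t)) (Fin (n t)) ℝ) (ε : ∀ t, Ω t → Fin (N t) → ℝ)
      (y : ∀ t, Ω t → Fin (N t) → ℝ) (βhat : ∀ t, Ω t → Fin (n t) → ℝ)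
      (Θhat : ∀ t, Matrix (Fin (N t)) (Fin (n t)) ℝ → Matrix (Fin (n t)) (Fin (n t)) ℝ)
      (j : ∀ t, GraphLasso.Edge (G t)),
    (∀ t, 0 < N t) → Tendsto n atTop atTop →
    (∀ t, 2 ≤ (G t).maxDegree) →
    (∀ t, 0 < s₁ t) → (∀ t, 0 < s₂ t) → (∀ t, ν ≤ (s₂ t : ℝ) / (s₁ t : ℝ)) →
    (∀ t, βs t ∈ GraphLasso.paramSpace (G t) k (s₁ t) (s₂ t)) →
    (∀ t, 0 < σε t) →
    -- the linear model with random design and Gaussian noise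
    (∀ t ω, y t ω = X t ω *ᵥ βs t + ε t ω) →
    (∀ t, GraphLasso.IsRowwiseSubGaussian σx (Sx t) (X t) (P t)) →
    (∀ t, spectrum ℝ (Sx t) ⊆ Set.Icc c₁ c₂) →
    (∀ t a, ∑ b, |(Sx t)⁻¹ a b| ≤ M t) →
    (∀ t, GraphLasso.IsGaussianNoise (σε t) (ε t) (P t)) →
    (∀ t, IndepFun (fun ω i => X t ω i) (ε t) (P t)) →
    -- the tuning parameters
    (∀ t, C₀ * (σε t * √(Real.log (n t) / N t)) ≤ lam t ∧
      lam t ≤ C₁ * (σε t * √(Real.log (n t) / N t))) →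
    (∀ t, C₀ * √(Real.log (n t) / N t) ≤ μ t ∧ μ t ≤ C₁ * √(Real.log (n t) / N t)) →
    -- the estimators
    (∀ t, Measurable (βhat t)) →
    (∀ t, ∀ᵐ ω ∂(P t), GraphLasso.IsGraphLasso (G t) k
      (lam t * √(ν / (2 * ((G t).maxDegree : ℝ)) ^ (k + 1))) (lam t) (X t ω)
      (y t ω) (βhat t ω)) →
    (∀ t, GraphLasso.IsCLIMEEstimator (μ t) (Θhat t)) →
    -- the growth conditions
    Tendsto (fun t => ((G t).maxDegree : ℝ) * M t * √(Real.log (n t) / N t)) atTop (𝓝 0) →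
    Tendsto (fun t => (s₂ t : ℝ) * Real.log (n t) * √(((G t).maxDegree : ℝ) / N t))
      atTop (𝓝 0) →
    -- asymptotic normality with known and with estimated noise level
    TendstoInDistribution
      (fun t ω => GraphLasso.edgeStat (G t) (j t) (σε t) (GraphLasso.incidence (G t) (j t) ⬝ᵥ βs t)
        (X t ω) (y t ω) (βhat t ω) (Θhat t (X t ω)))
      atTop (id : ℝ → ℝ) P (gaussianReal 0 1) ∧
    TendstoInDistribution
      (fun t ω => GraphLasso.edgeStat (G t) (j t) (GraphLasso.sigmaHat (X t ω) (y t ω) (βhat t ω))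
        (GraphLasso.incidence (G t) (j t) ⬝ᵥ βs t)
        (X t ω) (y t ω) (βhat t ω) (Θhat t (X t ω)))
      atTop (id : ℝ → ℝ) P (gaussianReal 0 1) ∧
    -- the resulting tests of equality along the edges have asymptotic level `α`
    ∀ α z : ℝ, 0 < α → α < 1 → cdf (gaussianReal 0 1) z = 1 - α / 2 →
      (∀ t, βs t (j t).1.1 = βs t (j t).1.2) →
      Tendsto (fun t => (P t).real {ω | z < |GraphLasso.edgeStat (G t) (j t) (σε t) 0
        (X t ω) (y t ω) (βhat t ω) (Θhat t (X t ω))|})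
        atTop (𝓝 α) ∧
      Tendsto (fun t => (P t).real {ω | z < |GraphLasso.edgeStat (G t) (j t) (GraphLasso.sigmaHat (X t ω) (y t ω) (βhat t ω)) 0
        (X t ω) (y t ω) (βhat t ω) (Θhat t (X t ω))|})
        atTop (𝓝 α) := by
  refine ⟨GraphLasso.tuningConst σx c₁ c₂, GraphLasso.tuningConst_pos hσx hc₁ c₂, ?_⟩
  intro C₁ k ν _ _ N n s₁ s₂ G _ βs Sx M σε lam μ Ω _ P _ X ε y βhat Θhat j hN hn hd hs₁ hs₂ hs hβs
    hσ hy hX hspec _ hε hind hlam hμ hβm hmin hΘ _ hgrow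
  obtain rfl : y = fun t ω => X t ω *ᵥ βs t + ε t ω := funext₂ hy
  have hd_pos (t) : 0 < (G t).maxDegree := two_pos.trans_le (hd t)
  obtain ⟨h_known, h_estimated, h_test⟩ := corollary4_general
    (fun t => .ofGraph (j t) hσx hc₁ (hN t) (hd_pos t) (hs₁ t) (hs₂ t) (hs t) (hβs t) (hσ t) (hX t)
      (hspec t) (hε t) (hind t) (hlam t) (hμ t) (hβm t) (hmin t) (hΘ t))
    hn (GraphLasso.tendsto_mul_log_div_sqrt hd_pos hgrow)
  refine ⟨h_known, h_estimated, fun α z _ hα hz h_null => h_test α z hα hz fun t => ?_⟩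
  exact (GraphLasso.incidence_dotProduct _ _ _).trans (sub_eq_zero.2 (h_null t).symm)
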